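/- A \emph{Hopf algebra} in a braided monoidal category with braiding $c$ is an object $H$ with a product $\mu:H\otimes H\to H$, unit $\eta$, coproduct $\Delta:H\to H\otimes H$, counit $\varepsilon$, and invertible antipode $S:H\to H$, such that $(\mu,\eta)$ is associative and unital, $(\Delta,\varepsilon)$ is coassociative and counital, $\Delta\circ\mu=(\mu\otimes\mu)\circ(\mathrm{id}\otimes c\otimes\mathrm{id})\circ(\Delta\otimes\Delta)$, $\varepsilon\circ\mu=\varepsilon\otimes\varepsilon$, $\Delta\circ\eta=\eta\otimes\eta$, $\varepsilon\circ\eta=\mathrm{id}_{\mathbb 1}$ and $\mu\circ(S\otimes\mathrm{id})\circ\Delta=\eta\circ\varepsilon=\mu\circ(\mathrm{id}\otimes S)\circ\Delta$. Its left adjoint action $\mathrm{ad}=\mu\circ(\mu\otimes S)\circ(\mathrm{id}\otimes c)\circ(\Delta\otimes\mathrm{id})$ is \emph{braided cocommutative} if $(\mathrm{ad}\otimes\mathrm{id})\circ(\mathrm{id}\otimes c)\circ(\Delta\otimes\mathrm{id})=c^{-1}\circ(\mathrm{id}\otimes\mathrm{ad})\circ(\Delta\otimes\mathrm{id})$. Consider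 a Hopf algebra $H$ with braided cocommutative left adjoint action, a copairing $w:\mathbb 1\to H\otimes H$, a ribbon element $v_+:\mathbb 1\to H$ and its inverse $v_-:\mathbb 1\to H$, satisfying $$\mu\circ(v_+\otimes\mathrm{id})=\mu\circ(\mathrm{id}\otimes v_+),\quad \mu\circ(v_+\otimes v_-)=\eta,\quad \varepsilon\circ v_+=\mathrm{id}_{\mathbb 1},\quad S\circ v_+=v_+,$$ $$w=(\mu\otimes\mu)\circ(v_-\otimes\mathrm{id}_{H\otimes H}\otimes v_-)\circ\Delta\circ v_+,\quad (\mathrm{id}\otimes\Delta)\circ w=(\mu\otimes\mathrm{id}_{H\otimes H})\circ(\mathrm{id}\otimes w\otimes\mathrm{id})\circ w.$$ It is a \emph{Kerler Hopf algebra} if it is moreover equipped with an integral form $\lambda:H\to\mathbb 1$ and an integral element $\Lambda:\mathbb 1\to H$ satisfying $$(\mathrm{id}\otimes\lambda)\circ\Delta=\eta\circ\lambda,\quad \mu\circ(\Lambda\otimes\mathrm{id})=\Lambda\circ\varepsilon,\quad \lambda\circ\Lambda=\mathrm{id}_{\mathbb 1},\quad S\circ\Lambda=\Lambda,\quad \lambda\circ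 S=\lambda,$$ $$(\lambda\otimes\mathrm{id})\circ w=\Lambda,\quad \lambda\circ v_+=\mathrm{id}_{\mathbb 1}.$$ It is a \emph{Habiro Hopf algebra} if it is instead equipped with a pairing $\bar w:H\otimes H\to\mathbb 1$ satisfying $$(\mathrm{id}\otimes\bar w)\circ(w\otimes\mathrm{id})=\mathrm{id}=(\bar w\otimes\mathrm{id})\circ(\mathrm{id}\otimes w),\quad \bar w\circ(\mu\otimes v_+)\circ(v_+\otimes v_+)=\mathrm{id}_{\mathbb 1},\quad S^2=(\mathrm{id}\otimes\bar w)\circ(c\otimes\mathrm{id})\circ(\mathrm{id}\otimes w).$$ Let $3\mathrm{Alg}^{\mathrm K}$ (respectively $3\mathrm{Alg}^{\mathrm H}$) be the strict braided monoidal category freely generated by a Kerler (respectively Habiro) Hopf algebra $H$: its objects are the tensor powers $H^{n}$, $n\ge 0$, and its morphisms are compositions of tensor products of identities, braidings and their inverses, and the structure morphisms, modulo the axioms of a strict braided monoidal category and the axioms of a Kerler (respectively Habiro) Hopf algebra. \textbf{Corollary.} There exists a braided monoidal functor $3\mathrm{Alg}^{\mathrm K}\to 3\mathrm{Alg}^{\mathrm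 H}$ that is an equivalence of categories and that preserves the corresponding Hopf algebra structures: it sends the generating object to the generating object (up to an isomorphism), carrying $\mu,\eta,\Delta,\varepsilon,S$, as well as $w,v_+,v_-$, to the structure morphisms of the same name. -/

import Mathlib

open CategoryTheory MonoidalCategory

/-!
# Strict braided monoidal categories presented by generators and relations

The objects of such a category are the tensor powers `H ^ n` of one object `H`, recorded by
`n : ℕ`, and the tensor product of objects is addition.  Morphisms are formal expressions in
identities, braidings and generating morphisms, modulo the axioms of a strict braided monoidal
category and a given family of relations.
-/

/-- Formal expressions for morphisms `H ^ m ⟶ H ^ n`, built from a family `G` of generators.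
`comp g f` is the composite `g ∘ f` (first `f`, then `g`), `braid m n` is the braiding
`c_{m,n} : H ^ m ⊗ H ^ n ⟶ H ^ n ⊗ H ^ m`, and `braidInv m n` is its inverse. -/
inductive BTerm (G : ℕ → ℕ → Type) : ℕ → ℕ → Type
  | gen {m n : ℕ} (x : G m n) : BTerm G m n
  | id (n : ℕ) : BTerm G n n
  | comp {l m n : ℕ} (g : BTerm G m n) (f : BTerm G l m) : BTerm G l n
  | tensor {a b c d : ℕ} (f : BTerm G a b) (g : BTerm G c d) : BTerm G (a + c) (b + d)
  | braid (m n : ℕ) : BTerm G (m + n) (n + m)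
  | braidInv (m n : ℕ) : BTerm G (n + m) (m + n)

infixr:80 " ⊚ " => BTerm.comp
notation:85 f:86 " ⊠ " g:85 => (BTerm.tensor f g :)

namespace BTerm

/-- The identity of `H ^ m = H ^ n`, for two expressions `m`, `n` of the same number. -/
def cast {G : ℕ → ℕ → Type} {m n : ℕ} (h : m = n) : BTerm G m n := h ▸ BTerm.id m

/-- The congruence on formal expressions generated by the axioms of a strict braided monoidal
category and by the relations `R`. -/
inductive Congr {G : ℕ → ℕ → Type} (R : ∀ ⦃m n : ℕ⦄, BTerm G m n → BTerm G m n → Prop) :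
    ∀ {m n : ℕ}, BTerm G m n → BTerm G m n → Prop
  -- the given relations
  | ax {m n : ℕ} {f g : BTerm G m n} (h : R f g) : Congr R f g
  -- an equivalence relation, compatible with composition and tensor product
  | refl {m n : ℕ} (f : BTerm G m n) : Congr R f f
  | symm {m n : ℕ} {f g : BTerm G m n} (h : Congr R f g) : Congr R g f
  | trans {m n : ℕ} {f g k : BTerm G m n} (h : Congr R f g) (h' : Congr R g k) : Congr R f k
  | comp_congr {l m n : ℕ} {g g' : BTerm G m n} {f f' : BTerm G l m}
      (hg : Congr R g g') (hf : Congr R f f') : Congr R (g ⊚ f) (g' ⊚ f')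
  | tensor_congr {a b c d : ℕ} {f f' : BTerm G a b} {g g' : BTerm G c d}
      (hf : Congr R f f') (hg : Congr R g g') : Congr R (f ⊠ g) (f' ⊠ g')
  -- category axioms
  | id_comp {m n : ℕ} (f : BTerm G m n) : Congr R (BTerm.id n ⊚ f) f
  | comp_id {m n : ℕ} (f : BTerm G m n) : Congr R (f ⊚ BTerm.id m) f
  | comp_assoc {k l m n : ℕ} (h : BTerm G m n) (g : BTerm G l m) (f : BTerm G k l) :
      Congr R ((h ⊚ g) ⊚ f) (h ⊚ (g ⊚ f))
  -- the tensor product is a functor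
  | tensor_id (m n : ℕ) : Congr R (BTerm.id m ⊠ BTerm.id n) (BTerm.id (m + n))
  | tensor_comp {a b c a' b' c' : ℕ} (g : BTerm G b c) (f : BTerm G a b)
      (g' : BTerm G b' c') (f' : BTerm G a' b') :
      Congr R ((g ⊚ f) ⊠ (g' ⊚ f')) ((g ⊠ g') ⊚ (f ⊠ f'))
  -- it is strictly associative and unital
  | tensor_assoc {a b c d j k : ℕ} (f : BTerm G a b) (g : BTerm G c d) (h : BTerm G j k) :
      Congr R (cast (Nat.add_assoc b d k) ⊚ ((f ⊠ g) ⊠ h))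
        ((f ⊠ (g ⊠ h)) ⊚ cast (Nat.add_assoc a c j))
  | unit_tensor {m n : ℕ} (f : BTerm G m n) :
      Congr R (cast (Nat.zero_add n) ⊚ (BTerm.id 0 ⊠ f)) (f ⊚ cast (Nat.zero_add m))
  | tensor_unit {m n : ℕ} (f : BTerm G m n) :
      Congr R (cast (Nat.add_zero n) ⊚ (f ⊠ BTerm.id 0)) (f ⊚ cast (Nat.add_zero m))
  -- the braiding is a natural isomorphism
  | braidInv_braid (m n : ℕ) : Congr R (braidInv m n ⊚ braid m n) (BTerm.id (m + n))
  | braid_braidInv (m n : ℕ) : Congr R (braid m n ⊚ braidInv m n) (BTerm.id (n + m))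
  | braid_naturality {a b c d : ℕ} (f : BTerm G a b) (g : BTerm G c d) :
      Congr R (braid b d ⊚ (f ⊠ g)) ((g ⊠ f) ⊚ braid a c)
  -- `c_{X ⊗ Y, Z} = (c_{X, Z} ⊗ id_Y) ∘ (id_X ⊗ c_{Y, Z})`
  | braid_tensor_left (l m n : ℕ) :
      Congr R (braid (l + m) n)
        (cast (Nat.add_assoc n l m) ⊚ (braid l n ⊠ BTerm.id m) ⊚
          cast (Nat.add_assoc l n m).symm ⊚ (BTerm.id l ⊠ braid m n) ⊚
          cast (Nat.add_assoc l m n))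
  -- `c_{X, Y ⊗ Z} = (id_Y ⊗ c_{X, Z}) ∘ (c_{X, Y} ⊗ id_Z)`
  | braid_tensor_right (l m n : ℕ) :
      Congr R (braid l (m + n))
        (cast (Nat.add_assoc m n l).symm ⊚ (BTerm.id m ⊠ braid l n) ⊚
          cast (Nat.add_assoc m l n) ⊚ (braid l m ⊠ BTerm.id n) ⊚
          cast (Nat.add_assoc l m n).symm)

section Casts

variable {G : ℕ → ℕ → Type} {R : ∀ ⦃m n : ℕ⦄, BTerm G m n → BTerm G m n → Prop}

theorem cast_comp_cast {l m n : ℕ} (h : m = n) (h' : l = m) :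
    Congr R (cast h ⊚ cast h') (cast (h'.trans h)) := by
  subst h; subst h'; exact Congr.id_comp _

theorem cast_tensor_cast {a b c d : ℕ} (h : a = b) (h' : c = d) :
    Congr R (cast h ⊠ cast h') (cast (by rw [h, h'])) := by
  subst h; subst h'; exact Congr.tensor_id _ _

end Casts

end BTerm

/-- The type of objects of the strict braided monoidal category with generating morphisms `G`
and relations `R`; the object `⟨n⟩` is the `n`-th tensor power of the generating object. -/
structure PresObj {G : ℕ → ℕ → Type}
    (R : ∀ ⦃m n : ℕ⦄, BTerm G m n → BTerm G m n → Prop) where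
  size : ℕ

namespace PresObj

variable {G : ℕ → ℕ → Type} {R : ∀ ⦃m n : ℕ⦄, BTerm G m n → BTerm G m n → Prop}

/-- The congruence `BTerm.Congr R` as a setoid. -/
def homSetoid (R : ∀ ⦃m n : ℕ⦄, BTerm G m n → BTerm G m n → Prop) (m n : ℕ) :
    Setoid (BTerm G m n) where
  r := BTerm.Congr R
  iseqv := ⟨BTerm.Congr.refl, BTerm.Congr.symm, BTerm.Congr.trans⟩

instance : Category (PresObj R) where
  Hom X Y := Quotient (homSetoid R X.size Y.size)
  id X := Quotient.mk _ (BTerm.id X.size)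
  comp f g := Quotient.map₂ (fun f g => g ⊚ f)
    (fun _ _ hf _ _ hg => BTerm.Congr.comp_congr hg hf) f g
  id_comp f := by
    induction f using Quotient.inductionOn
    exact Quotient.sound (BTerm.Congr.comp_id _)
  comp_id f := by
    induction f using Quotient.inductionOn
    exact Quotient.sound (BTerm.Congr.id_comp _)
  assoc f g h := by
    induction f using Quotient.inductionOn
    induction g using Quotient.inductionOn
    induction h using Quotient.inductionOn
    exact Quotient.sound (BTerm.Congr.comp_assoc _ _ _).symm

/-- The morphism represented by a formal expression. -/
def homMk (R : ∀ ⦃m n : ℕ⦄, BTerm G m n → BTerm G m n → Prop) {m n : ℕ} (t : BTerm G m n) :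
    (⟨m⟩ : PresObj R) ⟶ ⟨n⟩ := Quotient.mk (homSetoid R m n) t

theorem homMk_eq {m n : ℕ} {s t : BTerm G m n} (h : BTerm.Congr R s t) :
    homMk R s = homMk R t := Quotient.sound h

/-- The identity of `H ^ m = H ^ n` as an isomorphism. -/
def castIso (R : ∀ ⦃m n : ℕ⦄, BTerm G m n → BTerm G m n → Prop) {m n : ℕ} (h : m = n) :
    (⟨m⟩ : PresObj R) ≅ ⟨n⟩ where
  hom := homMk R (BTerm.cast h)
  inv := homMk R (BTerm.cast h.symm)
  hom_inv_id := homMk_eq (BTerm.cast_comp_cast h.symm h)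
  inv_hom_id := homMk_eq (BTerm.cast_comp_cast h h.symm)

/-- Tensor product of morphisms. -/
def tensorMap {X Y X' Y' : PresObj R} (f : X ⟶ Y) (g : X' ⟶ Y') :
    (⟨X.size + X'.size⟩ : PresObj R) ⟶ ⟨Y.size + Y'.size⟩ :=
  Quotient.map₂ (fun f g => f ⊠ g) (fun _ _ hf _ _ hg => BTerm.Congr.tensor_congr hf hg) f g

instance : MonoidalCategoryStruct (PresObj R) where
  tensorObj X Y := ⟨X.size + Y.size⟩
  whiskerLeft X _ _ f := tensorMap (𝟙 X) f
  whiskerRight f Y := tensorMap f (𝟙 Y)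
  tensorHom f g := tensorMap f g
  tensorUnit := ⟨0⟩
  associator X Y Z := castIso R (Nat.add_assoc X.size Y.size Z.size)
  leftUnitor X := castIso R (Nat.zero_add X.size)
  rightUnitor X := castIso R (Nat.add_zero X.size)

instance : MonoidalCategory (PresObj R) where
  tensorHom_def f g := by
    induction f using Quotient.inductionOn
    induction g using Quotient.inductionOn
    exact homMk_eq ((BTerm.Congr.tensor_congr (BTerm.Congr.id_comp _).symm
      (BTerm.Congr.comp_id _).symm).trans (BTerm.Congr.tensor_comp _ _ _ _))
  id_tensorHom_id X Y := homMk_eq (BTerm.Congr.tensor_id _ _)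
  tensorHom_comp_tensorHom f g h k := by
    induction f using Quotient.inductionOn
    induction g using Quotient.inductionOn
    induction h using Quotient.inductionOn
    induction k using Quotient.inductionOn
    exact homMk_eq (BTerm.Congr.tensor_comp _ _ _ _).symm
  whiskerLeft_id X Y := homMk_eq (BTerm.Congr.tensor_id _ _)
  id_whiskerRight X Y := homMk_eq (BTerm.Congr.tensor_id _ _)
  associator_naturality f g h := by
    induction f using Quotient.inductionOn
    induction g using Quotient.inductionOn
    induction h using Quotient.inductionOn
    exact homMk_eq (BTerm.Congr.tensor_assoc _ _ _)
  leftUnitor_naturality f := by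
    induction f using Quotient.inductionOn
    exact homMk_eq (BTerm.Congr.unit_tensor _)
  rightUnitor_naturality f := by
    induction f using Quotient.inductionOn
    exact homMk_eq (BTerm.Congr.tensor_unit _)
  pentagon W X Y Z := homMk_eq
    ((BTerm.Congr.comp_congr
      ((BTerm.Congr.comp_congr (BTerm.cast_tensor_cast (h := rfl) _) (.refl _)).trans
        (BTerm.cast_comp_cast _ _))
      (BTerm.cast_tensor_cast (h' := rfl) _)).trans
      ((BTerm.cast_comp_cast _ _).trans (BTerm.cast_comp_cast _ _).symm))
  triangle X Y := homMk_eq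
    ((BTerm.Congr.comp_congr (BTerm.cast_tensor_cast (h := rfl) _) (.refl _)).trans
      ((BTerm.cast_comp_cast _ _).trans (BTerm.cast_tensor_cast (h' := rfl) _).symm))

/-- The braiding isomorphism. -/
def braidIso (X Y : PresObj R) : X ⊗ Y ≅ Y ⊗ X where
  hom := homMk R (BTerm.braid X.size Y.size)
  inv := homMk R (BTerm.braidInv X.size Y.size)
  hom_inv_id := homMk_eq (BTerm.Congr.braidInv_braid _ _)
  inv_hom_id := homMk_eq (BTerm.Congr.braid_braidInv _ _)

instance : BraidedCategory (PresObj R) where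
  braiding X Y := braidIso X Y
  braiding_naturality_right X Y Z f := by
    induction f using Quotient.inductionOn
    exact homMk_eq (BTerm.Congr.braid_naturality _ _)
  braiding_naturality_left f Z := by
    induction f using Quotient.inductionOn
    exact homMk_eq (BTerm.Congr.braid_naturality _ _)
  hexagon_forward X Y Z := by
    have h : (braidIso X (Y ⊗ Z)).hom = (α_ X Y Z).inv ≫ ((braidIso X Y).hom ▷ Z) ≫
        (α_ Y X Z).hom ≫ (Y ◁ (braidIso X Z).hom) ≫ (α_ Y Z X).inv := by
      refine (homMk_eq (BTerm.Congr.braid_tensor_right X.size Y.size Z.size)).trans ?_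
      simp only [← Category.assoc]
      rfl
    rw [h]; simp
  hexagon_reverse X Y Z := by
    have h : (braidIso (X ⊗ Y) Z).hom = (α_ X Y Z).hom ≫ (X ◁ (braidIso Y Z).hom) ≫
        (α_ X Z Y).inv ≫ ((braidIso X Z).hom ▷ Y) ≫ (α_ Z X Y).hom := by
      refine (homMk_eq (BTerm.Congr.braid_tensor_left X.size Y.size Z.size)).trans ?_
      simp only [← Category.assoc]
      rfl
    rw [h]; simp

end PresObj

/-!
# Braided Hopf algebras in terms of generators and relations
-/

/-- The structure morphisms of a braided Hopf algebra `H` with invertible antipode. -/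
structure HopfTerms (G : ℕ → ℕ → Type) where
  mul : BTerm G 2 1
  unit : BTerm G 0 1
  comul : BTerm G 1 2
  counit : BTerm G 1 0
  antipode : BTerm G 1 1
  antipodeInv : BTerm G 1 1

namespace HopfTerms

variable {G : ℕ → ℕ → Type} (T : HopfTerms G)

/-- The left adjoint action `μ ∘ (μ ⊗ S) ∘ (id ⊗ c) ∘ (Δ ⊗ id) : H ⊗ H ⟶ H`. -/
def ad : BTerm G 2 1 :=
  T.mul ⊚ (T.mul ⊠ T.antipode) ⊚ (.id 1 ⊠ .braid 1 1) ⊚ (T.comul ⊠ .id 1)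

/-- The axioms of a braided Hopf algebra (with invertible antipode). -/
inductive HopfRel : ∀ ⦃m n : ℕ⦄, BTerm G m n → BTerm G m n → Prop
  | mul_assoc : HopfRel (T.mul ⊚ (T.mul ⊠ .id 1)) (T.mul ⊚ (.id 1 ⊠ T.mul))
  | unit_mul : HopfRel (T.mul ⊚ (T.unit ⊠ .id 1)) (.id 1)
  | mul_unit : HopfRel (T.mul ⊚ (.id 1 ⊠ T.unit)) (.id 1)
  | comul_assoc : HopfRel ((T.comul ⊠ .id 1) ⊚ T.comul) ((.id 1 ⊠ T.comul) ⊚ T.comul)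
  | counit_comul : HopfRel ((T.counit ⊠ .id 1) ⊚ T.comul) (.id 1)
  | comul_counit : HopfRel ((.id 1 ⊠ T.counit) ⊚ T.comul) (.id 1)
  | mul_comul : HopfRel
      ((T.mul ⊠ T.mul) ⊚ (.id 1 ⊠ .braid 1 1 ⊠ .id 1) ⊚ (T.comul ⊠ T.comul)) (T.comul ⊚ T.mul)
  | mul_counit : HopfRel (T.counit ⊚ T.mul) (T.counit ⊠ T.counit)
  | unit_comul : HopfRel (T.comul ⊚ T.unit) (T.unit ⊠ T.unit)
  | unit_counit : HopfRel (T.counit ⊚ T.unit) (.id 0)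
  | antipode_left : HopfRel (T.mul ⊚ (T.antipode ⊠ .id 1) ⊚ T.comul) (T.unit ⊚ T.counit)
  | antipode_right : HopfRel (T.mul ⊚ (.id 1 ⊠ T.antipode) ⊚ T.comul) (T.unit ⊚ T.counit)
  | antipode_inv : HopfRel (T.antipode ⊚ T.antipodeInv) (.id 1)
  | inv_antipode : HopfRel (T.antipodeInv ⊚ T.antipode) (.id 1)

/-- Braided cocommutativity of the left adjoint action:
`(ad ⊗ id) ∘ (id ⊗ c) ∘ (Δ ⊗ id) = c⁻¹ ∘ (id ⊗ ad) ∘ (Δ ⊗ id)`. -/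
inductive AdCocommRel : ∀ ⦃m n : ℕ⦄, BTerm G m n → BTerm G m n → Prop
  | ad_cocomm : AdCocommRel
      ((T.ad ⊠ .id 1) ⊚ (.id 1 ⊠ .braid 1 1) ⊚ (T.comul ⊠ .id 1))
      (.braidInv 1 1 ⊚ (.id 1 ⊠ T.ad) ⊚ (T.comul ⊠ .id 1))

/-- The axioms for a copairing `w` and a ribbon element `vp` with inverse `vm`, which are common
to Habiro Hopf algebras and Kerler Hopf algebras. -/
inductive RibbonRel (w : BTerm G 0 2) (vp vm : BTerm G 0 1) :
    ∀ ⦃m n : ℕ⦄, BTerm G m n → BTerm G m n → Prop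
  | central : RibbonRel w vp vm (T.mul ⊚ (vp ⊠ .id 1)) (T.mul ⊚ (.id 1 ⊠ vp))
  | inverse : RibbonRel w vp vm (T.mul ⊚ (vp ⊠ vm)) T.unit
  | counit : RibbonRel w vp vm (T.counit ⊚ vp) (.id 0)
  | antipode : RibbonRel w vp vm (T.antipode ⊚ vp) vp
  | copairing_def : RibbonRel w vp vm w
      ((T.mul ⊠ T.mul) ⊚ (vm ⊠ .id 2 ⊠ vm) ⊚ T.comul ⊚ vp)
  | copairing_comul : RibbonRel w vp vm ((.id 1 ⊠ T.comul) ⊚ w)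
      ((T.mul ⊠ .id 2) ⊚ (.id 1 ⊠ w ⊠ .id 1) ⊚ w)

end HopfTerms

/-- The generators of a braided Hopf algebra: product, unit, coproduct, counit, antipode and
inverse of the antipode. -/
inductive HopfGen : ℕ → ℕ → Type
  | mul : HopfGen 2 1
  | unit : HopfGen 0 1
  | comul : HopfGen 1 2
  | counit : HopfGen 1 0
  | antipode : HopfGen 1 1
  | antipodeInv : HopfGen 1 1

/-!
## Kerler Hopf algebras and the category `3Alg^K`
-/

/-- The generators of a Kerler Hopf algebra: those of a Hopf algebra, an integral form `λ`, an
integral element `Λ`, a copairing `w`, a ribbon element `v₊` and its inverse `v₋`. -/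
inductive KerlerGen : ℕ → ℕ → Type
  | hopf {m n : ℕ} (x : HopfGen m n) : KerlerGen m n
  | integralForm : KerlerGen 1 0
  | integralElement : KerlerGen 0 1
  | copairing : KerlerGen 0 2
  | ribbon : KerlerGen 0 1
  | ribbonInv : KerlerGen 0 1

namespace Kerler

/-- The Hopf algebra structure morphisms among the generators. -/
def terms : HopfTerms KerlerGen where
  mul := .gen (.hopf .mul)
  unit := .gen (.hopf .unit)
  comul := .gen (.hopf .comul)
  counit := .gen (.hopf .counit)
  antipode := .gen (.hopf .antipode)
  antipodeInv := .gen (.hopf .antipodeInv)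

/-- The integral form `λ`. -/
abbrev lam : BTerm KerlerGen 1 0 := .gen .integralForm
/-- The integral element `Λ`. -/
abbrev Lam : BTerm KerlerGen 0 1 := .gen .integralElement
/-- The copairing `w`. -/
abbrev w : BTerm KerlerGen 0 2 := .gen .copairing
/-- The ribbon element `v₊`. -/
abbrev vp : BTerm KerlerGen 0 1 := .gen .ribbon
/-- The inverse `v₋` of the ribbon element. -/
abbrev vm : BTerm KerlerGen 0 1 := .gen .ribbonInv

/-- The axioms of a Kerler Hopf algebra. -/
inductive Rel : ∀ ⦃m n : ℕ⦄, BTerm KerlerGen m n → BTerm KerlerGen m n → Prop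
  | hopf {m n : ℕ} {f g : BTerm KerlerGen m n} (h : terms.HopfRel f g) : Rel f g
  | ad_cocomm {m n : ℕ} {f g : BTerm KerlerGen m n} (h : terms.AdCocommRel f g) : Rel f g
  | ribbon {m n : ℕ} {f g : BTerm KerlerGen m n} (h : terms.RibbonRel w vp vm f g) : Rel f g
  | comul_integralForm : Rel ((.id 1 ⊠ lam) ⊚ terms.comul) (terms.unit ⊚ lam)
  | integralElement_mul : Rel (terms.mul ⊚ (Lam ⊠ .id 1)) (Lam ⊚ terms.counit)
  | integralForm_integralElement : Rel (lam ⊚ Lam) (.id 0)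
  | antipode_integralElement : Rel (terms.antipode ⊚ Lam) Lam
  | integralForm_antipode : Rel (lam ⊚ terms.antipode) lam
  | integralForm_copairing : Rel ((lam ⊠ .id 1) ⊚ w) Lam
  | integralForm_ribbon : Rel (lam ⊚ vp) (.id 0)

end Kerler

/-- The category `3Alg^K`: the strict braided monoidal category freely generated by a Kerler
Hopf algebra. -/
abbrev AlgK : Type := PresObj Kerler.Rel

/-!
## Habiro Hopf algebras and the category `3Alg^H`
-/

/-- The generators of a Habiro Hopf algebra: those of a Hopf algebra, a copairing `w`, a pairing
`w̄`, a ribbon element `v₊` and its inverse `v₋`. -/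
inductive HabiroGen : ℕ → ℕ → Type
  | hopf {m n : ℕ} (x : HopfGen m n) : HabiroGen m n
  | copairing : HabiroGen 0 2
  | pairing : HabiroGen 2 0
  | ribbon : HabiroGen 0 1
  | ribbonInv : HabiroGen 0 1

namespace Habiro

/-- The Hopf algebra structure morphisms among the generators. -/
def terms : HopfTerms HabiroGen where
  mul := .gen (.hopf .mul)
  unit := .gen (.hopf .unit)
  comul := .gen (.hopf .comul)
  counit := .gen (.hopf .counit)
  antipode := .gen (.hopf .antipode)
  antipodeInv := .gen (.hopf .antipodeInv)

/-- The copairing `w`. -/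
abbrev w : BTerm HabiroGen 0 2 := .gen .copairing
/-- The pairing `w̄`. -/
abbrev wbar : BTerm HabiroGen 2 0 := .gen .pairing
/-- The ribbon element `v₊`. -/
abbrev vp : BTerm HabiroGen 0 1 := .gen .ribbon
/-- The inverse `v₋` of the ribbon element. -/
abbrev vm : BTerm HabiroGen 0 1 := .gen .ribbonInv

/-- The axioms of a Habiro Hopf algebra. -/
inductive Rel : ∀ ⦃m n : ℕ⦄, BTerm HabiroGen m n → BTerm HabiroGen m n → Prop
  | hopf {m n : ℕ} {f g : BTerm HabiroGen m n} (h : terms.HopfRel f g) : Rel f g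
  | ad_cocomm {m n : ℕ} {f g : BTerm HabiroGen m n} (h : terms.AdCocommRel f g) : Rel f g
  | ribbon {m n : ℕ} {f g : BTerm HabiroGen m n} (h : terms.RibbonRel w vp vm f g) : Rel f g
  | zigzag_left : Rel ((.id 1 ⊠ wbar) ⊚ (w ⊠ .id 1)) (.id 1)
  | zigzag_right : Rel ((wbar ⊠ .id 1) ⊚ (.id 1 ⊠ w)) (.id 1)
  | pairing_ribbon : Rel (wbar ⊚ (terms.mul ⊠ vp) ⊚ (vp ⊠ vp)) (.id 0)
  | antipode_sq : Rel (terms.antipode ⊚ terms.antipode)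
      ((.id 1 ⊠ wbar) ⊚ (.braid 1 1 ⊠ .id 1) ⊚ (.id 1 ⊠ w))

end Habiro

/-- The category `3Alg^H`: the strict braided monoidal category freely generated by a Habiro
Hopf algebra. -/
abbrev AlgH : Type := PresObj Habiro.Rel

/-!
## The generating Hopf algebras
-/

namespace PresObj

variable {G : ℕ → ℕ → Type} {R : ∀ ⦃m n : ℕ⦄, BTerm G m n → BTerm G m n → Prop}

theorem homMk_ax {m n : ℕ} {s t : BTerm G m n} (h : R s t) : homMk R s = homMk R t :=
  homMk_eq (BTerm.Congr.ax h)

/-- If the relations contain the axioms of a braided Hopf algebra, then the generating object is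
a Hopf algebra. -/
@[reducible] def hopfObj (T : HopfTerms G) (hT : ∀ ⦃m n : ℕ⦄ (f g : BTerm G m n),
    T.HopfRel f g → R f g) : HopfObj (⟨1⟩ : PresObj R) where
  mul := homMk R T.mul
  one := homMk R T.unit
  comul := homMk R T.comul
  counit := homMk R T.counit
  antipode := homMk R T.antipode
  one_mul := homMk_ax (hT _ _ .unit_mul)
  mul_one := homMk_ax (hT _ _ .mul_unit)
  mul_assoc := homMk_eq (.trans (.ax (hT _ _ .mul_assoc)) (.symm (.comp_id _)))
  counit_comul := homMk_ax (hT _ _ .counit_comul)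
  comul_counit := homMk_ax (hT _ _ .comul_counit)
  comul_assoc := homMk_eq (.trans (.symm (.ax (hT _ _ .comul_assoc)))
    (.comp_congr (.symm (.id_comp _)) (.refl _)))
  mul_comul := by
    have key : tensorμ (⟨1⟩ : PresObj R) ⟨1⟩ ⟨1⟩ ⟨1⟩ =
        homMk R (.id 1 ⊠ .braid 1 1 ⊠ .id 1) := by
      refine (homMk_eq (t := .id 1 ⊠ .braid 1 1 ⊠ .id 1) ?_)
      refine .trans (.comp_congr (.comp_congr (.comp_congr (.comp_congr (.refl _)
        (.tensor_id 1 3)) (.refl _)) (.tensor_id 1 3)) (.refl _)) ?_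
      exact .trans (.comp_id _) (.trans (.comp_congr (.trans (.comp_congr (.id_comp _) (.refl _))
        (.id_comp _)) (.refl _)) (.comp_id _))
    rw [key]
    exact homMk_eq (.symm (.trans (.comp_assoc _ _ _) (.ax (hT _ _ .mul_comul))))
  one_comul := homMk_eq (.trans (.ax (hT _ _ .unit_comul)) (.symm (.comp_id _)))
  mul_counit := homMk_eq (.trans (.ax (hT _ _ .mul_counit)) (.symm (.id_comp _)))
  one_counit := homMk_ax (hT _ _ .unit_counit)
  antipode_left := homMk_eq (.trans (.comp_assoc _ _ _) (.ax (hT _ _ .antipode_left)))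
  antipode_right := homMk_eq (.trans (.comp_assoc _ _ _) (.ax (hT _ _ .antipode_right)))

end PresObj

namespace AlgK

/-- The generating object of `3Alg^K`. -/
abbrev H : AlgK := ⟨1⟩

instance : HopfObj H := PresObj.hopfObj Kerler.terms fun _ _ _ _ h => .hopf h

/-- The copairing `w` of the generating Kerler Hopf algebra. -/
def copairing : 𝟙_ AlgK ⟶ H ⊗ H := PresObj.homMk _ Kerler.w
/-- The ribbon element `v₊` of the generating Kerler Hopf algebra. -/
def ribbon : 𝟙_ AlgK ⟶ H := PresObj.homMk _ Kerler.vp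
/-- The inverse `v₋` of the ribbon element of the generating Kerler Hopf algebra. -/
def ribbonInv : 𝟙_ AlgK ⟶ H := PresObj.homMk _ Kerler.vm

end AlgK

namespace AlgH

/-- The generating object of `3Alg^H`. -/
abbrev H : AlgH := ⟨1⟩

instance : HopfObj H := PresObj.hopfObj Habiro.terms fun _ _ _ _ h => .hopf h

/-- The copairing `w` of the generating Habiro Hopf algebra. -/
def copairing : 𝟙_ AlgH ⟶ H ⊗ H := PresObj.homMk _ Habiro.w
/-- The ribbon element `v₊` of the generating Habiro Hopf algebra. -/
def ribbon : 𝟙_ AlgH ⟶ H := PresObj.homMk _ Habiro.vp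
/-- The inverse `v₋` of the ribbon element of the generating Habiro Hopf algebra. -/
def ribbonInv : 𝟙_ AlgH ⟶ H := PresObj.homMk _ Habiro.vm

end AlgH

open Functor.LaxMonoidal Functor.OplaxMonoidal in
/-- The isomorphism `e : F X ≅ Y` identifies the image under the monoidal functor `F` of the Hopf
algebra structure of `X` with that of `Y`. (Inverses of antipodes are then identified too.) -/
structure PreservesHopf {C D : Type*} [Category* C] [Category* D] [MonoidalCategory C]
    [MonoidalCategory D] [BraidedCategory C] [BraidedCategory D] (F : C ⥤ D) [F.Monoidal]
    {X : C} {Y : D} [HopfObj X] [HopfObj Y] (e : F.obj X ≅ Y) : Prop where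
  map_mul : F.map (MonObj.mul (X := X)) ≫ e.hom =
    δ F X X ≫ (e.hom ⊗ₘ e.hom) ≫ MonObj.mul (X := Y)
  map_unit : ε F ≫ F.map (MonObj.one (X := X)) ≫ e.hom = MonObj.one (X := Y)
  map_comul : F.map (ComonObj.comul (X := X)) ≫ δ F X X ≫ (e.hom ⊗ₘ e.hom) =
    e.hom ≫ ComonObj.comul (X := Y)
  map_counit : F.map (ComonObj.counit (X := X)) ≫ η F = e.hom ≫ ComonObj.counit (X := Y)
  map_antipode : F.map (HopfObj.antipode (X := X)) ≫ e.hom = e.hom ≫ HopfObj.antipode (X := Y)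

/-! Both kinds of Hopf algebra share μ, η, Δ, ε, S, w, v₊, v₋. It therefore suffices to express λ, Λ
through w̄ and w̄ through λ, to check that the axioms carry over, and to see that the two
substitutions undo each other. Braidings are suppressed in the formulas below, w = w′ ⊗ w″, and v₁ ⊗
v₂ = Δ(v₊).

From integrals to a pairing: w̄(y ⊗ x) = λ(w″y) λ(w′S(x)). The coproduct rule for w turns (id ⊗
w̄)(w ⊗ id) into Λ₁ λ(Λ₂S(x)), which by `integral_exchange` equals λ(ΛS(x₁)) x₂ = λ(Λ) x; this is
`IsIntegral.zigzag`. The other zigzag and the formula for S² are automatic (`pairing_flip`,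
`IsPairing.antipode_sq`), because w is invariant under (S ⊗ S) ∘ c and S can be moved from one leg
of w to the other. The normalization of w̄ follows from w · (v₊ ⊗ v₊) = Δ(v₊).

From a pairing to integrals: λ(x) = w̄(v₋ ⊗ v₋x) and Λ = λ(w′)w″. One finds λ(v₁)v₂ = 1, so the two
sides of the integral equation agree after precomposition with T(y) = v₁ w̄(v₂ ⊗ y). Since T has a
right inverse, λ is an integral (`comul_form`), and nondegeneracy of w̄ transfers this to Λ. Finally
λ(Λ) = 1 because the pairing rebuilt from λ is λ(Λ) · w̄, and both are normalized on v₊² ⊗ v₊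
(`element_form`).

Round trips: an inverse of w is unique, and `form_eq` recovers λ from the pairing it defines.

The calculations are done on germs, on which an expression acts by precomposition at a given strand.
Associators and identity factors disappear there, and a diagram becomes a word whose outermost
letter is applied first; strand numbers of later letters are counted after the earlier ones have
acted. `Congr.of_lay` returns from operators to expressions. -/

namespace PresObj

variable {G : ℕ → ℕ → Type} {R : ∀ ⦃m n : ℕ⦄, BTerm G m n → BTerm G m n → Prop}

/-! ### Morphisms acting on a block of strands, and germs -/

theorem castIso_comp {l m n : ℕ} (h : l = m) (h' : m = n) :
    (castIso R h).hom ≫ (castIso R h').hom = (castIso R (h.trans h')).hom :=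
  homMk_eq (BTerm.cast_comp_cast _ _)

theorem castIso_refl {m : ℕ} (h : m = m) : (castIso R h).hom = 𝟙 _ := rfl

/-- Precomposition of a morphism with unspecified target. -/
def precomp {m m' : ℕ} (k : (⟨m⟩ : PresObj R) ⟶ ⟨m'⟩)
    (s : Σ n : ℕ, ((⟨m'⟩ : PresObj R) ⟶ ⟨n⟩)) : Σ n : ℕ, ((⟨m⟩ : PresObj R) ⟶ ⟨n⟩) :=
  ⟨s.1, k ≫ s.2⟩

theorem precomp_precomp {l m n : ℕ} (k : (⟨l⟩ : PresObj R) ⟶ ⟨m⟩) (k' : (⟨m⟩ : PresObj R) ⟶ ⟨n⟩)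
    (s : Σ p : ℕ, ((⟨n⟩ : PresObj R) ⟶ ⟨p⟩)) : precomp k (precomp k' s) = precomp (k ≫ k') s := by
  simp [precomp]

theorem precomp_id {m : ℕ} (s : Σ n : ℕ, ((⟨m⟩ : PresObj R) ⟶ ⟨n⟩)) :
    precomp (𝟙 _) s = s := by
  simp [precomp]

variable (R) in
/-- Families of morphisms out of all tensor powers of the generating object. -/
abbrev Family : Type := ∀ m : ℕ, Σ n : ℕ, ((⟨m⟩ : PresObj R) ⟶ ⟨n⟩)

/-- Leaving the target unspecified pays off here: a change of source index is absorbed into the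
morphism as a cast, with no transport on the target. -/
theorem precomp_family {l m n : ℕ} (φ : Family R) (k : (⟨l⟩ : PresObj R) ⟶ ⟨m⟩) (h : m = n) :
    precomp k (φ m) = precomp (k ≫ (castIso R h).hom) (φ n) := by
  subst h; rw [castIso_refl, Category.comp_id]

/-- The morphism `f`, acting on the strands after the first `i` ones, with `r` strands to its
right. -/
def layer (i : ℕ) {a b : ℕ} (f : (⟨a⟩ : PresObj R) ⟶ ⟨b⟩) (r : ℕ) :
    (⟨i + a + r⟩ : PresObj R) ⟶ ⟨i + b + r⟩ := ((⟨i⟩ : PresObj R) ◁ f) ▷ ⟨r⟩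

theorem layer_comp (i : ℕ) {a b c : ℕ} (f : (⟨a⟩ : PresObj R) ⟶ ⟨b⟩)
    (g : (⟨b⟩ : PresObj R) ⟶ ⟨c⟩) (r : ℕ) :
    layer i (f ≫ g) r = layer i f r ≫ layer i g r := by
  rw [layer, MonoidalCategory.whiskerLeft_comp, comp_whiskerRight]; rfl

theorem layer_id (i a r : ℕ) : layer i (𝟙 (⟨a⟩ : PresObj R)) r = 𝟙 _ := by
  rw [layer, MonoidalCategory.whiskerLeft_id, id_whiskerRight]; rfl

theorem castIso_whiskerRight (X : PresObj R) {m n : ℕ} (h : m = n) :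
    (castIso R h).hom ▷ X = (castIso R (congrArg (· + X.size) h)).hom := by
  subst h; exact id_whiskerRight _ _

theorem associator_inv_eq (X Y Z : PresObj R) :
    (α_ X Y Z).inv = (castIso R (Nat.add_assoc X.size Y.size Z.size).symm).hom := rfl

theorem layer_whiskerRight (i : ℕ) {a b : ℕ} (f : (⟨a⟩ : PresObj R) ⟶ ⟨b⟩) (c r : ℕ)
    (h₁ : i + (a + c) + r = i + a + (c + r)) (h₂ : i + (b + c) + r = i + b + (c + r)) :
    layer i (f ▷ (⟨c⟩ : PresObj R)) r ≫ (castIso R h₂).hom =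
      (castIso R h₁).hom ≫ layer i f (c + r) := by
  have e₁ : (castIso R h₁).hom = ((α_ (⟨i⟩ : PresObj R) ⟨a⟩ ⟨c⟩).inv ▷ ⟨r⟩) ≫
      (α_ ((⟨i⟩ : PresObj R) ⊗ ⟨a⟩) ⟨c⟩ ⟨r⟩).hom := by
    rw [associator_inv_eq, castIso_whiskerRight]; exact (castIso_comp _ _).symm
  have e₂ : (castIso R h₂).hom = ((α_ (⟨i⟩ : PresObj R) ⟨b⟩ ⟨c⟩).inv ▷ ⟨r⟩) ≫
      (α_ ((⟨i⟩ : PresObj R) ⊗ ⟨b⟩) ⟨c⟩ ⟨r⟩).hom := by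
    rw [associator_inv_eq, castIso_whiskerRight]; exact (castIso_comp _ _).symm
  rw [e₁, e₂]
  change ((⟨i⟩ : PresObj R) ◁ (f ▷ ⟨c⟩)) ▷ ⟨r⟩ ≫ _ =
    _ ≫ (((⟨i⟩ : PresObj R) ◁ f) ▷ ((⟨c⟩ : PresObj R) ⊗ ⟨r⟩))
  simp

theorem layer_whiskerLeft (i : ℕ) {a b : ℕ} (f : (⟨a⟩ : PresObj R) ⟶ ⟨b⟩) (c r : ℕ)
    (h₁ : i + (c + a) + r = i + c + a + r) (h₂ : i + (c + b) + r = i + c + b + r) :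
    layer i ((⟨c⟩ : PresObj R) ◁ f) r ≫ (castIso R h₂).hom =
      (castIso R h₁).hom ≫ layer (i + c) f r := by
  have e₁ : (castIso R h₁).hom = ((α_ (⟨i⟩ : PresObj R) ⟨c⟩ ⟨a⟩).inv ▷ ⟨r⟩) := by
    rw [associator_inv_eq, castIso_whiskerRight]
  have e₂ : (castIso R h₂).hom = ((α_ (⟨i⟩ : PresObj R) ⟨c⟩ ⟨b⟩).inv ▷ ⟨r⟩) := by
    rw [associator_inv_eq, castIso_whiskerRight]
  rw [e₁, e₂]
  change ((⟨i⟩ : PresObj R) ◁ (⟨c⟩ ◁ f)) ▷ ⟨r⟩ ≫ _ =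
    _ ≫ ((((⟨i⟩ : PresObj R) ⊗ ⟨c⟩) ◁ f) ▷ (⟨r⟩ : PresObj R))
  simp only [← comp_whiskerRight]
  simp

/-- The family obtained from `φ` by first applying `f` to the strands after the first `i` ones. -/
def Family.apply {a b : ℕ} (f : (⟨a⟩ : PresObj R) ⟶ ⟨b⟩) (i : ℕ) (φ : Family R) : Family R :=
  fun m => if h : i + a ≤ m then
    precomp ((castIso R (Nat.add_sub_of_le h).symm).hom ≫ layer i f (m - (i + a)))
      (φ (i + b + (m - (i + a))))
  -- Too few strands: an arbitrary value, invisible in the germ.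
  else ⟨m, 𝟙 _⟩

theorem Family.apply_eq {a b : ℕ} (f : (⟨a⟩ : PresObj R) ⟶ ⟨b⟩) (i : ℕ) (φ : Family R)
    {m r : ℕ} (h : m = i + a + r) :
    φ.apply f i m = precomp ((castIso R h).hom ≫ layer i f r) (φ (i + b + r)) := by
  have hr : r = m - (i + a) := by omega
  subst hr
  rw [Family.apply, dif_pos (by omega : i + a ≤ m)]

instance familySetoid : Setoid (Family R) where
  r φ ψ := ∃ N, ∀ m ≥ N, φ m = ψ m
  iseqv := ⟨fun _ => ⟨0, fun _ _ => rfl⟩, fun ⟨N, h⟩ => ⟨N, fun m hm => (h m hm).symm⟩,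
    fun ⟨N, h⟩ ⟨N', h'⟩ => ⟨max N N', fun m hm => (h m (le_of_max_le_left hm)).trans
      (h' m (le_of_max_le_right hm))⟩⟩

variable (R) in
/-- Germs at infinity of families of morphisms out of the tensor powers. In a germ there are
always enough strands for a given morphism to act on. -/
def Germ : Type := Quotient (familySetoid (R := R))

/-- Precomposition of a germ with `f`, acting on the strands after the first `i` ones. -/
def act {a b : ℕ} (f : (⟨a⟩ : PresObj R) ⟶ ⟨b⟩) (i : ℕ) : Germ R → Germ R :=
  Quotient.map (Family.apply f i) fun φ ψ ⟨N, h⟩ => ⟨i + a + N, fun m hm => by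
    obtain ⟨r, rfl⟩ := Nat.exists_eq_add_of_le (show i + a ≤ m by omega)
    rw [Family.apply_eq f i φ rfl, Family.apply_eq f i ψ rfl, h _ (by omega)]⟩

theorem act_comp {a b c : ℕ} (f : (⟨a⟩ : PresObj R) ⟶ ⟨b⟩) (g : (⟨b⟩ : PresObj R) ⟶ ⟨c⟩) (i : ℕ)
    (x : Germ R) : act (f ≫ g) i x = act f i (act g i x) := by
  induction x using Quotient.inductionOn with | _ φ
  refine Quotient.sound ⟨i + a, fun m hm => ?_⟩
  obtain ⟨r, rfl⟩ := Nat.exists_eq_add_of_le hm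
  rw [Family.apply_eq _ _ _ rfl, Family.apply_eq _ _ _ rfl, Family.apply_eq g i φ rfl,
    precomp_precomp, castIso_refl, castIso_refl, Category.id_comp, Category.id_comp,
    Category.id_comp, layer_comp]

theorem act_id (a i : ℕ) (x : Germ R) : act (𝟙 (⟨a⟩ : PresObj R)) i x = x := by
  induction x using Quotient.inductionOn with | _ φ
  refine Quotient.sound ⟨i + a, fun m hm => ?_⟩
  obtain ⟨r, rfl⟩ := Nat.exists_eq_add_of_le hm
  rw [Family.apply_eq _ _ _ rfl, castIso_refl, layer_id, Category.id_comp, precomp_id]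

theorem act_castIso {a b : ℕ} (h : a = b) (i : ℕ) (x : Germ R) :
    act (castIso R h).hom i x = x := by
  subst h; exact act_id _ _ _

theorem act_whiskerRight {a b : ℕ} (f : (⟨a⟩ : PresObj R) ⟶ ⟨b⟩) (c i : ℕ) (x : Germ R) :
    act (a := a + c) (b := b + c) (f ▷ (⟨c⟩ : PresObj R)) i x = act f i x := by
  induction x using Quotient.inductionOn with | _ φ
  refine Quotient.sound ⟨i + (a + c), fun m hm => ?_⟩
  obtain ⟨r, rfl⟩ := Nat.exists_eq_add_of_le hm
  rw [Family.apply_eq _ _ _ rfl,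
    Family.apply_eq f i φ (r := c + r) (by omega : i + (a + c) + r = i + a + (c + r)),
    precomp_family φ _ (by omega : i + (b + c) + r = i + b + (c + r)), castIso_refl,
    Category.id_comp, layer_whiskerRight]

theorem act_whiskerLeft {a b : ℕ} (f : (⟨a⟩ : PresObj R) ⟶ ⟨b⟩) (c i : ℕ) (x : Germ R) :
    act (a := c + a) (b := c + b) ((⟨c⟩ : PresObj R) ◁ f) i x = act f (i + c) x := by
  induction x using Quotient.inductionOn with | _ φ
  refine Quotient.sound ⟨i + (c + a), fun m hm => ?_⟩
  obtain ⟨r, rfl⟩ := Nat.exists_eq_add_of_le hm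
  rw [Family.apply_eq _ _ _ rfl,
    Family.apply_eq f (i + c) φ (r := r) (by omega : i + (c + a) + r = i + c + a + r),
    precomp_family φ _ (by omega : i + (c + b) + r = i + c + b + r), castIso_refl,
    Category.id_comp, layer_whiskerLeft]

theorem act_tensor {a b c d : ℕ} (f : (⟨a⟩ : PresObj R) ⟶ ⟨b⟩) (g : (⟨c⟩ : PresObj R) ⟶ ⟨d⟩)
    (i : ℕ) (x : Germ R) :
    act (a := a + c) (b := b + d) (f ⊗ₘ g) i x = act f i (act g (i + b) x) := by
  rw [MonoidalCategory.tensorHom_def]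
  exact (act_comp (a := a + c) (b := b + c) (c := b + d) _ _ i x).trans
    ((act_whiskerRight f c i _).trans (congrArg _ (act_whiskerLeft g b i x)))

theorem act_tensor' {a b c d : ℕ} (f : (⟨a⟩ : PresObj R) ⟶ ⟨b⟩) (g : (⟨c⟩ : PresObj R) ⟶ ⟨d⟩)
    (i : ℕ) (x : Germ R) :
    act (a := a + c) (b := b + d) (f ⊗ₘ g) i x = act g (i + a) (act f i x) := by
  rw [MonoidalCategory.tensorHom_def']
  exact (act_comp (a := a + c) (b := a + d) (c := b + d) _ _ i x).trans
    ((act_whiskerLeft g a i _).trans (congrArg _ (act_whiskerRight f d i x)))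

/-- Disjoint layers commute. -/
theorem act_comm {a b c d : ℕ} (f : (⟨a⟩ : PresObj R) ⟶ ⟨b⟩) (g : (⟨c⟩ : PresObj R) ⟶ ⟨d⟩)
    (i k : ℕ) (x : Germ R) :
    act f i (act g (i + b + k) x) = act g (i + a + k) (act f i x) := by
  have h := (act_tensor f ((⟨k⟩ : PresObj R) ◁ g) i x).symm.trans
    (act_tensor' f ((⟨k⟩ : PresObj R) ◁ g) i x)
  exact ((congrArg (act f i) (act_whiskerLeft g k (i + b) x)).symm.trans h).trans
    (act_whiskerLeft g k (i + a) _)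

theorem exists_section (u : (⟨0⟩ : PresObj R) ⟶ ⟨1⟩) (e : (⟨1⟩ : PresObj R) ⟶ ⟨0⟩)
    (hue : u ≫ e = 𝟙 _) (N : ℕ) :
    ∃ (uN : 𝟙_ (PresObj R) ⟶ ⟨N⟩) (eN : (⟨N⟩ : PresObj R) ⟶ 𝟙_ _), uN ≫ eN = 𝟙 _ := by
  induction N with
  | zero => exact ⟨𝟙 _, 𝟙 _, Category.id_comp _⟩
  | succ N ih =>
    obtain ⟨uN, eN, hN⟩ := ih
    refine ⟨(uN ⊗ₘ u : (⟨0 + 0⟩ : PresObj R) ⟶ ⟨N + 1⟩), (eN ⊗ₘ e :), ?_⟩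
    have := MonoidalCategory.tensorHom_comp_tensorHom uN u eN e
    rw [hN, hue] at this
    exact this.trans (MonoidalCategory.id_tensorHom_id _ _)

/-- If the generating object has a unit with a left inverse, then tensoring with `H ^ N` is
faithful. -/
theorem whiskerRight_injective (u : (⟨0⟩ : PresObj R) ⟶ ⟨1⟩) (e : (⟨1⟩ : PresObj R) ⟶ ⟨0⟩)
    (hue : u ≫ e = 𝟙 _) (N : ℕ) {X Y : PresObj R} {f g : X ⟶ Y}
    (h : f ▷ (⟨N⟩ : PresObj R) = g ▷ ⟨N⟩) : f = g := by
  obtain ⟨uN, eN, hN⟩ := exists_section u e hue N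
  have key : ∀ k : X ⟶ Y, k = (ρ_ X).inv ≫ X ◁ uN ≫ k ▷ ⟨N⟩ ≫ Y ◁ eN ≫ (ρ_ Y).hom := by
    intro k
    rw [← whisker_exchange_assoc, ← MonoidalCategory.whiskerLeft_comp_assoc, hN]
    simp
  rw [key f, key g, h]

end PresObj

/-! ### Formal expressions as operators on germs -/

/-- The action of a formal expression on germs. -/
def BTerm.lay {G : ℕ → ℕ → Type} (R : ∀ ⦃m n : ℕ⦄, BTerm G m n → BTerm G m n → Prop)
    {a b : ℕ} (t : BTerm G a b) (i : ℕ) (x : PresObj.Germ R) : PresObj.Germ R :=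
  PresObj.act (PresObj.homMk R t) i x

namespace BTerm

variable {G : ℕ → ℕ → Type} {R : ∀ ⦃m n : ℕ⦄, BTerm G m n → BTerm G m n → Prop}

theorem Congr.lay_eq {a b : ℕ} {s t : BTerm G a b} (h : Congr R s t) (i : ℕ)
    (x : PresObj.Germ R) : lay R s i x = lay R t i x := by
  rw [lay, lay, PresObj.homMk_eq h]

theorem lay_comp {a b c : ℕ} (g : BTerm G b c) (f : BTerm G a b) (i : ℕ) (x : PresObj.Germ R) :
    lay R (g ⊚ f) i x = lay R f i (lay R g i x) :=
  PresObj.act_comp (PresObj.homMk R f) (PresObj.homMk R g) i x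

theorem lay_id (a i : ℕ) (x : PresObj.Germ R) : lay R (.id a) i x = x := PresObj.act_id _ _ _

theorem lay_cast {a b : ℕ} (h : a = b) (i : ℕ) (x : PresObj.Germ R) : lay R (cast h) i x = x :=
  PresObj.act_castIso h _ _

theorem lay_tensor {a b c d : ℕ} (f : BTerm G a b) (g : BTerm G c d) (i : ℕ)
    (x : PresObj.Germ R) : lay R (f ⊠ g) i x = lay R f i (lay R g (i + b) x) :=
  PresObj.act_tensor (PresObj.homMk R f) (PresObj.homMk R g) i x

/-- Disjoint layers commute: the one on the right can be applied first. -/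
theorem lay_comm {a b c d : ℕ} (f : BTerm G a b) (g : BTerm G c d) {i j : ℕ} (h : i + b ≤ j)
    (x : PresObj.Germ R) : lay R f i (lay R g j x) = lay R g (j - b + a) (lay R f i x) := by
  obtain ⟨k, rfl⟩ := Nat.exists_eq_add_of_le h
  rw [show i + b + k - b + a = i + a + k by omega]
  exact PresObj.act_comm _ _ _ _ _

/-- Disjoint layers commute: the one on the left can be applied first. -/
theorem lay_comm' {a b c d : ℕ} (f : BTerm G a b) (g : BTerm G c d) {i j : ℕ} (h : j + c ≤ i)
    (x : PresObj.Germ R) : lay R f i (lay R g j x) = lay R g j (lay R f (i - c + d) x) := by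
  rw [lay_comm g f (by omega), show i - c + d - d + c = i by omega]

-- With literal offsets from a common `i`, `simp` can check the side condition. The rule always
-- moves the layer on the right outwards, so `simp` identifies diagrams that differ by interchange
-- of disjoint layers.
@[simp]
theorem lay_comm_add {a b c d : ℕ} (f : BTerm G a b) (g : BTerm G c d) {i p q : ℕ} (h : p + b ≤ q)
    (x : PresObj.Germ R) :
    lay R f (i + p) (lay R g (i + q) x) = lay R g (i + (q - b + a)) (lay R f (i + p) x) := by
  rw [lay_comm f g (by omega), show i + q - b + a = i + (q - b + a) by omega]

@[simp]
theorem lay_comm_zero_add {a b c d : ℕ} (f : BTerm G a b) (g : BTerm G c d) {i q : ℕ} (h : b ≤ q)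
    (x : PresObj.Germ R) :
    lay R f i (lay R g (i + q) x) = lay R g (i + (q - b + a)) (lay R f i x) :=
  lay_comm_add f g (p := 0) (by omega) x

@[simp]
theorem lay_comm_zero {a c d : ℕ} (f : BTerm G a 0) (g : BTerm G c d) {i : ℕ}
    (x : PresObj.Germ R) : lay R f i (lay R g i x) = lay R g (i + a) (lay R f i x) := by
  rw [lay_comm f g (by omega)]; rfl

theorem lay_comm_left {a b c d : ℕ} (f : BTerm G a b) (g : BTerm G c d) {i p : ℕ} (h : c ≤ p)
    (x : PresObj.Germ R) :
    lay R f (i + p) (lay R g i x) = lay R g i (lay R f (i + (p - c + d)) x) := by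
  rw [lay_comm' f g (by omega), show i + p - c + d = i + (p - c + d) by omega]

/-- Faithfulness of the action: applied to the germ of identities, the operator of `s` gives back
`s` with `N` extra strands, and these can be removed because the unit is split by the counit. -/
theorem Congr.of_lay {u : BTerm G 0 1} {e : BTerm G 1 0} (hue : Congr R (e ⊚ u) (.id 0)) {a b : ℕ}
    {s t : BTerm G a b} (h : ∀ x, lay R s 0 x = lay R t 0 x) : Congr R s t := by
  obtain ⟨N, hN⟩ := Quotient.exact (h (Quotient.mk _ fun m => ⟨m, 𝟙 _⟩))
  -- Position 0, `a` inputs, and `N` further strands to pass the threshold of the germ.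
  have hN := hN (0 + a + N) (by omega)
  rw [PresObj.Family.apply_eq _ _ _ rfl, PresObj.Family.apply_eq _ _ _ rfl,
    PresObj.castIso_refl, Category.id_comp, Category.id_comp] at hN
  simp only [PresObj.precomp, Category.comp_id, Sigma.mk.injEq, heq_eq_eq, true_and] at hN
  have h₁ := PresObj.whiskerRight_injective (PresObj.homMk R u) (PresObj.homMk R e)
    (PresObj.homMk_eq hue) N hN
  have key : ∀ k : (⟨a⟩ : PresObj R) ⟶ ⟨b⟩,
      k = (λ_ (⟨a⟩ : PresObj R)).inv ≫ (⟨0⟩ : PresObj R) ◁ k ≫ (λ_ (⟨b⟩ : PresObj R)).hom := by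
    intro k
    exact ((Iso.inv_comp_eq _).2 (leftUnitor_naturality k)).symm
  exact Quotient.exact ((key _).trans ((congrArg (fun k => (λ_ (⟨a⟩ : PresObj R)).inv ≫ k ≫
    (λ_ (⟨b⟩ : PresObj R)).hom) h₁).trans (key _).symm))

/-!
### Naturality of the braiding, in terms of the action on germs
-/

theorem lay_braid_add_left (l m n i : ℕ) (x : PresObj.Germ R) :
    lay R (.braid (l + m) n) i x = lay R (.braid m n) (i + l) (lay R (.braid l n) i x) := by
  rw [(Congr.braid_tensor_left l m n).lay_eq]
  simp only [lay_comp, lay_cast, lay_tensor, lay_id]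

theorem lay_braid_add_right (l m n i : ℕ) (x : PresObj.Germ R) :
    lay R (.braid l (m + n)) i x = lay R (.braid l m) i (lay R (.braid l n) (i + m) x) := by
  rw [(Congr.braid_tensor_right l m n).lay_eq]
  simp only [lay_comp, lay_cast, lay_tensor, lay_id]

theorem lay_braid_braidInv (m n i : ℕ) (x : PresObj.Germ R) :
    lay R (.braidInv m n) i (lay R (.braid m n) i x) = x := by
  rw [← lay_comp, (Congr.braid_braidInv m n).lay_eq, lay_id]

/-- The hexagon makes this braiding idempotent, and an invertible idempotent is the identity. -/
theorem lay_braid_zero_left (n i : ℕ) (x : PresObj.Germ R) : lay R (.braid 0 n) i x = x := by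
  have h : lay R (.braid 0 n) i x = lay R (.braid 0 n) i (lay R (.braid 0 n) i x) :=
    lay_braid_add_left 0 0 n i x
  have h' := congrArg (lay R (.braidInv 0 n) i) h
  rw [lay_braid_braidInv, lay_braid_braidInv] at h'
  exact h'.symm

theorem lay_braid_zero_right (n i : ℕ) (x : PresObj.Germ R) : lay R (.braid n 0) i x = x := by
  have h : lay R (.braid n 0) i x = lay R (.braid n 0) i (lay R (.braid n 0) i x) :=
    lay_braid_add_right n 0 0 i x
  have h' := congrArg (lay R (.braidInv n 0) i) h
  rw [lay_braid_braidInv, lay_braid_braidInv] at h'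
  exact h'.symm

theorem lay_braid_natural_left {a b : ℕ} (t : BTerm G a b) (n i : ℕ) (x : PresObj.Germ R) :
    lay R t i (lay R (.braid b n) i x) = lay R (.braid a n) i (lay R t (i + n) x) := by
  have h := (Congr.braid_naturality (R := R) t (.id n)).lay_eq i x
  simpa only [lay_comp, lay_tensor, lay_id] using h

theorem lay_braid_natural_right {a b : ℕ} (t : BTerm G a b) (n i : ℕ) (x : PresObj.Germ R) :
    lay R t (i + n) (lay R (.braid n b) i x) = lay R (.braid n a) i (lay R t i x) := by
  have h := (Congr.braid_naturality (R := R) (.id n) t).lay_eq i x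
  simpa only [lay_comp, lay_tensor, lay_id] using h

theorem lay_braid_two_one (i : ℕ) (x : PresObj.Germ R) :
    lay R (.braid 2 1) i x = lay R (.braid 1 1) (i + 1) (lay R (.braid 1 1) i x) :=
  lay_braid_add_left 1 1 1 i x

theorem lay_braid_one_two (i : ℕ) (x : PresObj.Germ R) :
    lay R (.braid 1 2) i x = lay R (.braid 1 1) i (lay R (.braid 1 1) (i + 1) x) :=
  lay_braid_add_right 1 1 1 i x

/-- Naturality of the braiding with one strand, since braiding with the tensor unit is trivial. -/
theorem lay_scalar (t : BTerm G 0 0) (i : ℕ) (x : PresObj.Germ R) :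
    lay R t (i + 1) x = lay R t i x := by
  have h := lay_braid_natural_left t 1 i x
  rwa [lay_braid_zero_left, lay_braid_zero_left, eq_comm] at h

/-! ### Sliding a morphism of small arity across one strand -/

section Strand

variable (i : ℕ) (x : PresObj.Germ R)

local notation "𝐜" => lay R (BTerm.braid 1 1)

theorem strand_right₂₁ (t : BTerm G 2 1) :
    lay R t i (𝐜 i x) = 𝐜 (i + 1) (𝐜 i (lay R t (i + 1) x)) := by
  rw [lay_braid_natural_left, lay_braid_two_one]

@[simp]
theorem strand_right₀₁ (t : BTerm G 0 1) : lay R t i (𝐜 i x) = lay R t (i + 1) x := by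
  rw [lay_braid_natural_left, lay_braid_zero_left]

@[simp]
theorem strand_right₁₀ (t : BTerm G 1 0) : 𝐜 i (lay R t (i + 1) x) = lay R t i x := by
  rw [← lay_braid_natural_left, lay_braid_zero_left]

theorem strand_right₁₁ (t : BTerm G 1 1) : lay R t i (𝐜 i x) = 𝐜 i (lay R t (i + 1) x) :=
  lay_braid_natural_left _ _ _ _

theorem strand_right₀₂ (t : BTerm G 0 2) :
    lay R t i (𝐜 (i + 1) (𝐜 i x)) = lay R t (i + 1) x := by
  rw [← lay_braid_two_one, lay_braid_natural_left, lay_braid_zero_left]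

theorem strand_right₂₀ (t : BTerm G 2 0) :
    𝐜 (i + 1) (𝐜 i (lay R t (i + 1) x)) = lay R t i x := by
  rw [← lay_braid_two_one, ← lay_braid_natural_left, lay_braid_zero_left]

theorem strand_left₂₁ (t : BTerm G 2 1) :
    lay R t (i + 1) (𝐜 i x) = 𝐜 i (𝐜 (i + 1) (lay R t i x)) := by
  rw [lay_braid_natural_right, lay_braid_one_two]

theorem strand_left₁₂ (t : BTerm G 1 2) :
    lay R t (i + 1) (𝐜 i (𝐜 (i + 1) x)) = 𝐜 i (lay R t i x) := by
  rw [← lay_braid_one_two, lay_braid_natural_right]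

@[simp]
theorem strand_left₀₁ (t : BTerm G 0 1) : lay R t (i + 1) (𝐜 i x) = lay R t i x := by
  rw [lay_braid_natural_right, lay_braid_zero_right]

@[simp]
theorem strand_left₁₀ (t : BTerm G 1 0) : 𝐜 i (lay R t i x) = lay R t (i + 1) x := by
  rw [← lay_braid_natural_right, lay_braid_zero_right]

theorem strand_left₁₁ (t : BTerm G 1 1) : lay R t (i + 1) (𝐜 i x) = 𝐜 i (lay R t i x) :=
  lay_braid_natural_right _ _ _ _

theorem strand_left₀₂ (t : BTerm G 0 2) :
    lay R t (i + 1) (𝐜 i (𝐜 (i + 1) x)) = lay R t i x := by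
  rw [← lay_braid_one_two, lay_braid_natural_right, lay_braid_zero_right]

/-- The braid relation. -/
theorem yang_baxter : 𝐜 i (𝐜 (i + 1) (𝐜 i x)) = 𝐜 (i + 1) (𝐜 i (𝐜 (i + 1) x)) := by
  rw [← lay_braid_one_two, ← lay_braid_natural_right (.braid 1 1) 1, lay_braid_one_two]

end Strand

end BTerm

/-- A braided Hopf algebra with a copairing and a ribbon element, as common to Kerler and Habiro
Hopf algebras, among the formal expressions modulo the relations `R`. -/
structure RibbonHopf {G : ℕ → ℕ → Type} (R : ∀ ⦃m n : ℕ⦄, BTerm G m n → BTerm G m n → Prop)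
    extends HopfTerms G where
  w : BTerm G 0 2
  vp : BTerm G 0 1
  vm : BTerm G 0 1
  hopf : ∀ ⦃m n : ℕ⦄ (f g : BTerm G m n), toHopfTerms.HopfRel f g → R f g
  ribbon : ∀ ⦃m n : ℕ⦄ (f g : BTerm G m n), toHopfTerms.RibbonRel w vp vm f g → R f g

/-! ### Hopf algebra identities as identities of operators -/

namespace RibbonHopf

open BTerm HopfTerms

variable {G : ℕ → ℕ → Type} {R : ∀ ⦃m n : ℕ⦄, BTerm G m n → BTerm G m n → Prop}
  (A : RibbonHopf R) (i : ℕ) (x : PresObj.Germ R)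

/-- Multiplication by the ribbon element. -/
def tp : BTerm G 1 1 := A.mul ⊚ (A.vp ⊠ .id 1)

/-- Multiplication by the inverse of the ribbon element. -/
def tm : BTerm G 1 1 := A.mul ⊚ (A.vm ⊠ .id 1)

local notation "𝐜" => lay R (BTerm.braid 1 1)
local notation "𝐦" => lay R (HopfTerms.mul (toHopfTerms A))
local notation "𝐮" => lay R (HopfTerms.unit (toHopfTerms A))
local notation "𝐝" => lay R (HopfTerms.comul (toHopfTerms A))
local notation "𝐞" => lay R (HopfTerms.counit (toHopfTerms A))
local notation "𝐬" => lay R (HopfTerms.antipode (toHopfTerms A))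
local notation "𝐬⁻" => lay R (HopfTerms.antipodeInv (toHopfTerms A))
local notation "𝐰" => lay R (RibbonHopf.w A)
local notation "𝐯" => lay R (RibbonHopf.vp A)
local notation "𝐯⁻" => lay R (RibbonHopf.vm A)
local notation "𝐭" => lay R (RibbonHopf.tp A)
local notation "𝐭⁻" => lay R (RibbonHopf.tm A)

theorem congr_of_lay (A : RibbonHopf R) {a b : ℕ} {s t : BTerm G a b}
    (h : ∀ x, lay R s 0 x = lay R t 0 x) :
    Congr R s t :=
  Congr.of_lay (.ax (A.hopf _ _ .unit_counit)) h

theorem hopf_lay {a b : ℕ} {s t : BTerm G a b} (h : A.HopfRel s t) :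
    lay R s i x = lay R t i x := (Congr.ax (A.hopf _ _ h)).lay_eq i x

theorem ribbon_lay {a b : ℕ} {s t : BTerm G a b} (h : A.RibbonRel A.w A.vp A.vm s t) :
    lay R s i x = lay R t i x := (Congr.ax (A.ribbon _ _ h)).lay_eq i x

theorem mul_assoc : 𝐦 i (𝐦 i x) = 𝐦 (i + 1) (𝐦 i x) := by
  simpa only [lay_comp, lay_tensor, lay_id] using A.hopf_lay i x .mul_assoc

@[simp]
theorem unit_mul : 𝐮 i (𝐦 i x) = x := by
  simpa only [lay_comp, lay_tensor, lay_id] using A.hopf_lay i x .unit_mul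

@[simp]
theorem mul_unit : 𝐮 (i + 1) (𝐦 i x) = x := by
  simpa only [lay_comp, lay_tensor, lay_id] using A.hopf_lay i x .mul_unit

theorem comul_assoc : 𝐝 i (𝐝 i x) = 𝐝 i (𝐝 (i + 1) x) := by
  simpa only [lay_comp, lay_tensor, lay_id] using A.hopf_lay i x .comul_assoc

@[simp]
theorem counit_comul : 𝐝 i (𝐞 i x) = x := by
  simpa only [lay_comp, lay_tensor, lay_id] using A.hopf_lay i x .counit_comul

@[simp]
theorem comul_counit : 𝐝 i (𝐞 (i + 1) x) = x := by
  simpa only [lay_comp, lay_tensor, lay_id] using A.hopf_lay i x .comul_counit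

theorem mul_comul : 𝐦 i (𝐝 i x) = 𝐝 i (𝐝 (i + 2) (𝐜 (i + 1) (𝐦 i (𝐦 (i + 1) x)))) := by
  simpa only [lay_comp, lay_tensor, lay_id] using (A.hopf_lay i x .mul_comul).symm

theorem mul_counit : 𝐦 i (𝐞 i x) = 𝐞 i (𝐞 i x) := by
  simpa only [lay_comp, lay_tensor, lay_id, Nat.add_zero] using A.hopf_lay i x .mul_counit

theorem unit_comul : 𝐮 i (𝐝 i x) = 𝐮 i (𝐮 (i + 1) x) := by
  simpa only [lay_comp, lay_tensor, lay_id] using A.hopf_lay i x .unit_comul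

@[simp]
theorem unit_counit : 𝐮 i (𝐞 i x) = x := by
  simpa only [lay_comp, lay_tensor, lay_id] using A.hopf_lay i x .unit_counit

theorem antipode_left : 𝐝 i (𝐬 i (𝐦 i x)) = 𝐞 i (𝐮 i x) := by
  simpa only [lay_comp, lay_tensor, lay_id] using A.hopf_lay i x .antipode_left

@[simp]
theorem antipode_antipodeInv : 𝐬 i (𝐬⁻ i x) = x := by
  simpa only [lay_comp, lay_tensor, lay_id] using A.hopf_lay i x .inv_antipode

theorem antipode_comul : 𝐬 i (𝐝 i x) = 𝐝 i (𝐜 i (𝐬 i (𝐬 (i + 1) x))) := by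
  let := PresObj.hopfObj (R := R) A.toHopfTerms A.hopf
  have h : Congr R (A.comul ⊚ A.antipode)
      (((A.antipode ⊠ A.antipode) ⊚ .braid 1 1) ⊚ A.comul) :=
    Quotient.exact (HopfObj.antipode_comul (⟨1⟩ : PresObj R))
  simpa only [lay_comp, lay_tensor, lay_id] using h.lay_eq i x

theorem mul_antipode : 𝐦 i (𝐬 i x) = 𝐬 i (𝐬 (i + 1) (𝐜 i (𝐦 i x))) := by
  let := PresObj.hopfObj (R := R) A.toHopfTerms A.hopf
  have h : Congr R (A.antipode ⊚ A.mul)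
      ((A.mul ⊚ .braid 1 1) ⊚ (A.antipode ⊠ A.antipode)) :=
    Quotient.exact (HopfObj.mul_antipode (⟨1⟩ : PresObj R))
  simpa only [lay_comp, lay_tensor, lay_id] using h.lay_eq i x

@[simp]
theorem unit_antipode : 𝐮 i (𝐬 i x) = 𝐮 i x := by
  let := PresObj.hopfObj (R := R) A.toHopfTerms A.hopf
  have h : Congr R (A.antipode ⊚ A.unit) A.unit :=
    Quotient.exact (HopfObj.one_antipode (⟨1⟩ : PresObj R))
  simpa only [lay_comp] using h.lay_eq i x

@[simp]
theorem unit_antipodeInv : 𝐮 i (𝐬⁻ i x) = 𝐮 i x := by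
  rw [← unit_antipode, antipode_antipodeInv]

@[simp]
theorem antipode_counit : 𝐬 i (𝐞 i x) = 𝐞 i x := by
  let := PresObj.hopfObj (R := R) A.toHopfTerms A.hopf
  have h : Congr R (A.counit ⊚ A.antipode) A.counit :=
    Quotient.exact (HopfObj.antipode_counit (⟨1⟩ : PresObj R))
  simpa only [lay_comp] using h.lay_eq i x

/-!
### The ribbon element
-/

theorem tp_eq : 𝐭 i x = 𝐯 i (𝐦 i x) := by
  simp only [tp, lay_comp, lay_tensor, lay_id]

theorem tm_eq : 𝐭⁻ i x = 𝐯⁻ i (𝐦 i x) := by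
  simp only [tm, lay_comp, lay_tensor, lay_id]

theorem tp_eq' : 𝐭 i x = 𝐯 (i + 1) (𝐦 i x) := by
  rw [tp_eq]
  simpa only [lay_comp, lay_tensor, lay_id] using A.ribbon_lay i x .central

theorem ribbon_ribbonInv : 𝐯 i (𝐯⁻ (i + 1) (𝐦 i x)) = 𝐮 i x := by
  simpa only [lay_comp, lay_tensor, lay_id] using A.ribbon_lay i x .inverse

@[simp]
theorem ribbon_counit : 𝐯 i (𝐞 i x) = x := by
  simpa only [lay_comp, lay_tensor, lay_id] using A.ribbon_lay i x .counit

@[simp]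
theorem ribbon_antipode : 𝐯 i (𝐬 i x) = 𝐯 i x := by
  simpa only [lay_comp, lay_tensor, lay_id] using A.ribbon_lay i x .antipode

@[simp]
theorem ribbonInv_tp : 𝐯⁻ i (𝐭 i x) = 𝐮 i x := by
  rw [tp_eq, lay_comm' _ _ (by omega : i + 0 ≤ i)]
  exact A.ribbon_ribbonInv i x

@[simp]
theorem tm_tp : 𝐭⁻ i (𝐭 i x) = x := by
  rw [tm_eq, tp_eq, lay_comm' _ _ (by omega : i + 0 ≤ i), lay_comm' _ _ (by omega : i + 0 ≤ i)]
  simp only [Nat.sub_zero, ← mul_assoc, ribbon_ribbonInv, unit_mul]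

theorem tp_mul_ribbonInv : 𝐭 i (𝐯⁻ (i + 1) (𝐦 i x)) = x := by
  rw [tp_eq', lay_comm_zero_add _ _ le_rfl, mul_assoc, ribbon_ribbonInv, mul_unit]

/-- Left multiplication by v₋ is inverse to multiplication by the central v₊ on one side, right
multiplication on the other, so the two coincide. -/
theorem tm_eq' : 𝐭⁻ i x = 𝐯⁻ (i + 1) (𝐦 i x) := by
  rw [← A.tm_tp i (𝐯⁻ (i + 1) (𝐦 i x)), tp_mul_ribbonInv]

@[simp]
theorem tp_tm : 𝐭 i (𝐭⁻ i x) = x := by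
  rw [tm_eq', tp_mul_ribbonInv]

theorem ribbonInv_ribbon : 𝐯⁻ i (𝐯 (i + 1) (𝐦 i x)) = 𝐮 i x := by
  rw [← tp_eq', ribbonInv_tp]

theorem tp_antipode : 𝐭 i (𝐬 i x) = 𝐬 i (𝐭 i x) := by
  rw [tp_eq, tp_eq', mul_antipode]
  simp

@[simp]
theorem unit_tm : 𝐮 i (𝐭⁻ i x) = 𝐯⁻ i x := by
  rw [tm_eq']
  simp

@[simp]
theorem unit_tp : 𝐮 i (𝐭 i x) = 𝐯 i x := by
  rw [tp_eq']
  simp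

@[simp]
theorem ribbon_tm : 𝐯 i (𝐭⁻ i x) = 𝐮 i x := by
  rw [← unit_tp, tp_tm]

theorem tm_antipode : 𝐭⁻ i (𝐬 i x) = 𝐬 i (𝐭⁻ i x) := by
  have h := congrArg (𝐭⁻ i) (A.tp_antipode i (𝐭⁻ i x))
  rw [tm_tp, tp_tm] at h
  exact h.symm

@[simp]
theorem ribbonInv_antipode : 𝐯⁻ i (𝐬 i x) = 𝐯⁻ i x := by
  rw [← unit_tm, tm_antipode, unit_antipode, unit_tm]

@[simp]
theorem ribbonInv_counit : 𝐯⁻ i (𝐞 i x) = x := by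
  have h := A.ribbon_ribbonInv i (𝐞 i x)
  rw [mul_counit] at h
  simpa using h

@[simp]
theorem tm_counit : 𝐭⁻ i (𝐞 i x) = 𝐞 i x := by
  rw [tm_eq, mul_counit]
  simp

/-!
### The copairing
-/

theorem copairing_eq : 𝐰 i x = 𝐯 i (𝐝 i (𝐭⁻ i (𝐭⁻ (i + 1) x))) := by
  have h := A.ribbon_lay i x .copairing_def
  simp only [lay_comp, lay_tensor, lay_id] at h
  rw [h, tm_eq, tm_eq']
  simp [Nat.add_assoc]

theorem ribbon_comul : 𝐯 i (𝐝 i x) = 𝐰 i (𝐭 i (𝐭 (i + 1) x)) := by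
  rw [copairing_eq]
  simp

@[simp]
theorem copairing_counit_right : 𝐰 i (𝐞 (i + 1) x) = 𝐮 i x := by
  rw [copairing_eq, tm_counit]
  simp

@[simp]
theorem copairing_counit_left : 𝐰 i (𝐞 i x) = 𝐮 i x := by
  rw [copairing_eq, lay_comm_left _ _ le_rfl, tm_counit, counit_comul, Nat.add_zero, ribbon_tm]

theorem copairing_comul_right : 𝐰 i (𝐝 (i + 1) x) = 𝐰 i (𝐰 (i + 1) (𝐦 i x)) := by
  simpa only [lay_comp, lay_tensor, lay_id] using A.ribbon_lay i x .copairing_comul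

/-- S reverses the coproduct and fixes v₊ and v₋, from which w is built. -/
theorem copairing_flip : 𝐰 i (𝐜 i (𝐬 i (𝐬 (i + 1) x))) = 𝐰 i x := by
  calc _ = 𝐯 i (𝐝 i (𝐜 i (𝐭⁻ i (𝐬 i (𝐭⁻ (i + 1) (𝐬 (i + 1) x)))))) := by
        rw [copairing_eq]; simp [strand_left₁₁, strand_right₁₁]
    _ = 𝐯 i (𝐝 i (𝐜 i (𝐬 i (𝐬 (i + 1) (𝐭⁻ i (𝐭⁻ (i + 1) x)))))) := by
        rw [tm_antipode, tm_antipode]; simp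
    _ = _ := by rw [← antipode_comul, ribbon_antipode, copairing_eq]

/-- `copairing_flip` exchanges the legs of w and so carries the coproduct axiom from the right leg
to the left one. The remaining braidings disappear when the inner copairing slides across strands.
-/
theorem copairing_comul_left : 𝐰 i (𝐝 i x) = 𝐰 i (𝐰 (i + 1) (𝐦 (i + 2) x)) := by
  calc 𝐰 i (𝐝 i x)
    _ = 𝐰 i (𝐜 i (𝐬 i (𝐬 (i + 1) (𝐝 i x)))) := by rw [copairing_flip]
    _ = 𝐰 i (𝐜 i (𝐬 i (𝐝 i (𝐬 (i + 2) x)))) := by simp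
    _ = 𝐰 i (𝐜 i (𝐝 i (𝐜 i (𝐬 i (𝐬 (i + 1) (𝐬 (i + 2) x)))))) := by rw [antipode_comul]
    _ = 𝐰 i (𝐝 (i + 1) (𝐜 i (𝐜 (i + 1) (𝐜 i (𝐬 i (𝐬 (i + 1) (𝐬 (i + 2) x))))))) := by
        rw [strand_left₁₂]
    _ = 𝐰 i (𝐰 (i + 1) (𝐜 (i + 1) (𝐜 i (𝐜 (i + 2) (𝐜 (i + 1)
          (𝐦 (i + 2) (𝐜 i (𝐬 i (𝐬 (i + 1) (𝐬 (i + 2) x))))))))) ) := by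
        rw [copairing_comul_right, strand_right₂₁, strand_right₂₁]
    _ = 𝐰 i (𝐰 (i + 1) (𝐜 (i + 1) (𝐜 (i + 2) (𝐜 i (𝐜 (i + 1) (𝐜 i
          (𝐬 i (𝐬 (i + 1) (𝐦 (i + 2) (𝐬 (i + 2) x)))))))))) := by simp
    _ = 𝐰 i (𝐰 (i + 1) (𝐜 (i + 1) (𝐜 (i + 2) (𝐜 (i + 1) (𝐜 i (𝐜 (i + 1)
          (𝐬 i (𝐬 (i + 1) (𝐬 (i + 2) (𝐬 (i + 3) (𝐜 (i + 2) (𝐦 (i + 2) x))))))))))))  := by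
        rw [mul_antipode, yang_baxter]
    -- Bundled as a single morphism out of the unit, c ∘ w slides across strands by naturality.
    _ = 𝐰 i (lay R (.braid 1 1 ⊚ A.w) (i + 1) (𝐜 (i + 2) (𝐜 (i + 1) (𝐜 i (𝐜 (i + 1) (𝐜 (i + 2)
          (𝐬 i (𝐬 (i + 1) (𝐬 (i + 2) (𝐬 (i + 3) (𝐦 (i + 2) x))))))))))) := by
        rw [lay_comp]; simp [strand_left₁₁, strand_right₁₁, Nat.add_assoc]
    _ = 𝐰 i (𝐜 i (lay R (.braid 1 1 ⊚ A.w) (i + 1)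
          (𝐬 i (𝐬 (i + 1) (𝐬 (i + 2) (𝐬 (i + 3) (𝐦 (i + 2) x))))))) := by
        rw [strand_right₀₂, ← strand_left₀₂ (i + 1)]; simp [Nat.add_assoc]
    _ = 𝐰 i (𝐜 i (𝐰 (i + 1) (𝐜 (i + 1) (𝐬 (i + 1) (𝐬 (i + 1 + 1)
          (𝐬 i (𝐬 (i + 3) (𝐦 (i + 2) x)))))))) := by
        rw [lay_comp]; simp [Nat.add_assoc]
    _ = 𝐰 i (𝐜 i (𝐰 (i + 1) (𝐬 i (𝐬 (i + 3) (𝐦 (i + 2) x))))) := by rw [copairing_flip]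
    _ = 𝐰 i (𝐜 i (𝐬 i (𝐬 (i + 1) (𝐰 (i + 1) (𝐦 (i + 2) x))))) := by simp
    _ = _ := by rw [copairing_flip]

/-- The antipode can be moved across the copairing. -/
theorem copairing_antipode : 𝐰 i (𝐬 i x) = 𝐰 i (𝐬 (i + 1) x) := by
  -- For the nested product (a ⊗ b)(a′ ⊗ b′) = aa′ ⊗ b′b, (S ⊗ id)w is a left inverse of w and (id ⊗
  -- S)w a right inverse; hence they are equal.
  have h₁ : ∀ x, 𝐰 i (𝐬 i (𝐰 (i + 1) (𝐦 i (𝐦 (i + 1) x)))) = 𝐮 i (𝐮 (i + 1) x) := fun x => by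
    calc _ = 𝐰 i (𝐰 (i + 1) (𝐦 (i + 2) (𝐬 i (𝐦 i x)))) := by simp
      _ = 𝐰 i (𝐝 i (𝐬 i (𝐦 i x))) := by rw [copairing_comul_left]
      _ = _ := by rw [antipode_left, copairing_counit_left]; simp
  have h₂ : ∀ i x, 𝐰 i (𝐰 (i + 1) (𝐬 (i + 2) (𝐦 i (𝐦 (i + 1) x)))) = 𝐮 i (𝐮 (i + 1) x) :=
    fun i x => by
    calc _ = 𝐰 i (𝐰 (i + 1) (𝐦 i (𝐬 (i + 1) (𝐦 (i + 1) x)))) := by simp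
      _ = 𝐰 i (𝐝 (i + 1) (𝐬 (i + 1) (𝐦 (i + 1) x))) := by rw [copairing_comul_right]
      _ = _ := by rw [antipode_left, copairing_counit_right]
  calc 𝐰 i (𝐬 i x)
    _ = 𝐰 i (𝐬 i (𝐮 (i + 1) (𝐮 (i + 2) (𝐦 i (𝐦 (i + 1) x))))) := by simp
    _ = 𝐰 i (𝐬 i (𝐰 (i + 1) (𝐰 (i + 2) (𝐬 (i + 3) (𝐦 (i + 1) (𝐦 (i + 2)
          (𝐦 i (𝐦 (i + 1) x)))))))) := by rw [h₂]
    _ = 𝐰 i (𝐬 i (𝐰 (i + 1) (𝐰 (i + 2) (𝐬 (i + 3) (𝐦 (i + 3) (𝐦 (i + 3)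
          (𝐦 (i + 1) (𝐦 i x)))))))) := by simp
    _ = 𝐰 i (𝐬 i (𝐰 (i + 1) (𝐰 (i + 2) (𝐬 (i + 3) (𝐦 (i + 4) (𝐦 (i + 3)
          (𝐦 i (𝐦 i x)))))))) := by rw [mul_assoc, ← A.mul_assoc i]
    _ = 𝐰 i (𝐬 i (𝐰 (i + 1) (𝐦 i (𝐦 (i + 1) (𝐰 (i + 1) (𝐬 (i + 2) (𝐦 i (𝐦 (i + 1) x)))))))) := by
        simp
    _ = 𝐰 i (𝐬 (i + 1) (𝐮 (i + 1 + 1) (𝐦 (i + 1) x))) := by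
        rw [h₁]; simp [Nat.add_assoc, -mul_unit]
    _ = _ := by rw [mul_unit]

/-!
### Duality
-/

/-- The pairing `b` is inverse to the copairing `w`. -/
structure IsPairing (b : BTerm G 2 0) : Prop where
  left : ∀ i x, 𝐰 i (lay R b (i + 1) x) = x
  right : ∀ i x, 𝐰 (i + 1) (lay R b i x) = x

variable {A}

/-- The usual argument that a left and a right inverse coincide. -/
theorem pairing_unique {b b' : BTerm G 2 0} (hb : ∀ i x, 𝐰 (i + 1) (lay R b i x) = x)
    (hb' : ∀ i x, 𝐰 i (lay R b' (i + 1) x) = x) (i : ℕ) (x : PresObj.Germ R) :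
    lay R b' i x = lay R b i x := by
  calc _ = 𝐰 (i + 1) (lay R b i (lay R b' i x)) := by rw [hb]
    _ = 𝐰 (i + 1) (lay R b' (i + 1 + 1) (lay R b i x)) := by simp [Nat.add_assoc]
    _ = _ := by rw [hb']

/-- The symmetry of w turns the given zigzag into the opposite zigzag for b ∘ (S² ⊗ id) ∘ c; by
uniqueness this form is b itself. -/
theorem pairing_flip {b : BTerm G 2 0} (hb : ∀ i x, 𝐰 i (lay R b (i + 1) x) = x) (i : ℕ)
    (x : PresObj.Germ R) :
    lay R b i x = 𝐜 i (𝐬 i (𝐬 i (lay R b i x))) ∧ 𝐰 (i + 1) (lay R b i x) = x := by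
  -- The hypothesis `hb`, with w replaced by its flip.
  have h₁ : ∀ i x, 𝐰 (i + 1) (𝐜 i (𝐬 i (lay R b i (𝐬 i x)))) = x := fun i x => by
    calc _ = 𝐰 (i + 1) (𝐜 i (𝐬 i (𝐜 (i + 1) (𝐜 i (𝐬 i (lay R b (i + 1) x)))))) := by
          rw [← strand_right₂₀ i _ b]; simp
      _ = 𝐰 (i + 1) (𝐜 i (𝐜 (i + 1) (𝐜 i (𝐬 i (𝐬 (i + 1) (lay R b (i + 1) x)))))) := by
          simp [strand_right₁₁]
      _ = 𝐰 (i + 1) (𝐜 (i + 1) (𝐬 (i + 1) (𝐬 (i + 1 + 1) (𝐜 i (𝐜 (i + 1)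
            (lay R b (i + 1) x)))))) := by
          rw [yang_baxter, lay_comm_left (p := 2) A.antipode (.braid 1 1) (by decide)]
          simp [strand_left₁₁]
      _ = x := by rw [copairing_flip, strand_left₀₂, hb]
  have h₂ : ∀ i x, 𝐰 (i + 1)
      (lay R (b ⊚ ((A.antipode ⊚ A.antipode) ⊠ .id 1) ⊚ .braid 1 1) i x) = x := fun i x => by
    simp only [lay_comp, lay_tensor, lay_id]
    calc _ = 𝐰 (i + 1) (𝐬 (i + 1) (𝐜 i (𝐬 i (lay R b i x)))) := by
          rw [strand_left₁₁]
      _ = 𝐰 (i + 1) (𝐬 (i + 1 + 1) (𝐜 i (𝐬 i (lay R b i x)))) := by rw [copairing_antipode]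
      _ = 𝐰 (i + 1) (𝐜 i (𝐬 i (lay R b i (𝐬 i x)))) := by simp [Nat.add_assoc]
      _ = x := h₁ i x
  have h₃ := fun i x => pairing_unique h₂ hb i x
  refine ⟨(h₃ i x).trans ?_, by rw [h₃, h₂]⟩
  simp only [lay_comp, lay_tensor, lay_id]

/-- A left inverse of the copairing is a two-sided inverse. -/
theorem IsPairing.of_left {b : BTerm G 2 0} (hb : ∀ i x, 𝐰 i (lay R b (i + 1) x) = x) :
    A.IsPairing b :=
  ⟨hb, fun i x => (pairing_flip hb i x).2⟩

namespace IsPairing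

variable {b : BTerm G 2 0} (hb : A.IsPairing b) (i : ℕ) (x : PresObj.Germ R)

local notation "𝐛" => lay R b

/-- The coproduct rule for the left leg of w, transposed along the zigzags: w̄(xy ⊗ z) = w̄(y ⊗ z₁)
w̄(x ⊗ z₂), with the arguments nested so that no braiding occurs. -/
theorem mul_left (hb : A.IsPairing b) : 𝐦 i (𝐛 i x) = 𝐝 (i + 2) (𝐛 (i + 1) (𝐛 i x)) := by
  symm
  calc 𝐝 (i + 2) (𝐛 (i + 1) (𝐛 i x))
    _ = 𝐰 (i + 2) (𝐛 (i + 2 + 1) (𝐝 (i + 2) (𝐛 (i + 1) (𝐛 i x)))) := by rw [hb.left]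
    _ = 𝐰 (i + 2) (𝐝 (i + 2) (𝐛 (i + 4) (𝐛 (i + 1) (𝐛 i x)))) := by simp
    _ = 𝐰 (i + 2) (𝐰 (i + 3) (𝐦 (i + 4) (𝐛 (i + 4) (𝐛 (i + 1) (𝐛 i x))))) := by
      rw [copairing_comul_left]
    _ = 𝐰 (i + 1 + 1) (𝐛 (i + 1) (𝐰 (i + 1) (𝐛 i (𝐦 i (𝐛 i x))))) := by simp [Nat.add_assoc]
    _ = _ := by rw [hb.right, hb.right]

@[simp]
theorem unit_left (hb : A.IsPairing b) : 𝐮 i (𝐛 i x) = 𝐞 i x := by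
  rw [← copairing_counit_left, lay_comm_zero, hb.left]

@[simp]
theorem unit_right (hb : A.IsPairing b) : 𝐮 (i + 1) (𝐛 i x) = 𝐞 i x := by
  calc 𝐮 (i + 1) (𝐛 i x)
    _ = 𝐰 (i + 1) (𝐞 (i + 1 + 1) (𝐛 i x)) := by rw [copairing_counit_right]
    _ = 𝐰 (i + 1) (𝐛 i (𝐞 i x)) := by simp [Nat.add_assoc]
    _ = _ := hb.right _ _

theorem antipode (hb : A.IsPairing b) : 𝐬 i (𝐛 i x) = 𝐬 (i + 1) (𝐛 i x) := by
  calc 𝐬 i (𝐛 i x)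
    _ = 𝐰 (i + 1) (𝐛 i (𝐬 i (𝐛 i x))) := by rw [hb.right]
    _ = 𝐰 (i + 1) (𝐬 (i + 1 + 1) (𝐛 i (𝐛 i x))) := by simp [Nat.add_assoc]
    _ = 𝐰 (i + 1) (𝐬 (i + 1) (𝐛 i (𝐛 i x))) := by rw [copairing_antipode]
    _ = 𝐰 (i + 1) (𝐛 (i + 1 + 1) (𝐬 (i + 1) (𝐛 i x))) := by simp [Nat.add_assoc]
    _ = 𝐬 (i + 1) (𝐛 i x) := by rw [hb.left]

/-- The square of the antipode is determined by the copairing, the pairing and the braiding. -/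
theorem antipode_sq (hb : A.IsPairing b) : 𝐬 i (𝐬 i x) = 𝐰 (i + 1) (𝐜 i (𝐛 (i + 1) x)) := by
  symm
  calc 𝐰 (i + 1) (𝐜 i (𝐛 (i + 1) x))
    _ = 𝐰 i (𝐬 (i + 1) (𝐬 (i + 1) (𝐛 (i + 1) x))) := by
      rw [(pairing_flip hb.left (i + 1) x).1, strand_left₀₂, ← (pairing_flip hb.left (i + 1) x).1]
    _ = 𝐰 i (𝐬 i (𝐬 (i + 1) (𝐛 (i + 1) x))) := by rw [copairing_antipode]
    _ = 𝐰 i (𝐬 (i + 1) (𝐬 i (𝐛 (i + 1) x))) := by simp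
    _ = 𝐰 i (𝐬 i (𝐬 i (𝐛 (i + 1) x))) := by rw [copairing_antipode]
    _ = 𝐰 i (𝐛 (i + 1) (𝐬 i (𝐬 i x))) := by simp
    _ = _ := by rw [hb.left]

end IsPairing

/-!
### Integrals
-/

theorem comul_left_of_comul_right {lam : BTerm G 1 0}
    (hlam : ∀ i x, 𝐝 i (lay R lam (i + 1) x) = lay R lam i (𝐮 i x))
    (hs : ∀ i x, 𝐬 i (lay R lam i x) = lay R lam i x) (i : ℕ) (x : PresObj.Germ R) :
    𝐝 i (lay R lam i x) = lay R lam i (𝐮 i x) := by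
  calc 𝐝 i (lay R lam i x)
    _ = 𝐝 i (𝐜 i (lay R lam (i + 1) (𝐬 i (𝐬⁻ i x)))) := by simp
    _ = 𝐝 i (𝐜 i (𝐬 i (𝐬 (i + 1) (lay R lam (i + 1) (𝐬⁻ i x))))) := by rw [hs]; simp
    _ = 𝐬 i (𝐝 i (lay R lam (i + 1) (𝐬⁻ i x))) := by rw [antipode_comul]
    _ = _ := by rw [hlam, hs, unit_antipodeInv]

theorem comul_right_of_comul_left {lam : BTerm G 1 0}
    (hlam : ∀ i x, 𝐝 i (lay R lam i x) = lay R lam i (𝐮 i x))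
    (hs : ∀ i x, 𝐬 i (lay R lam i x) = lay R lam i x) (i : ℕ) (x : PresObj.Germ R) :
    𝐝 i (lay R lam (i + 1) x) = lay R lam i (𝐮 i x) := by
  calc 𝐝 i (lay R lam (i + 1) x)
    _ = 𝐝 i (𝐜 i (lay R lam i (𝐬 i (𝐬⁻ i x)))) := by simp
    _ = 𝐝 i (𝐜 i (𝐬 i (𝐬 (i + 1) (lay R lam i (𝐬⁻ i x))))) := by
      rw [lay_comm_zero_add _ _ le_rfl, hs]; simp
    _ = 𝐬 i (𝐝 i (lay R lam i (𝐬⁻ i x))) := by rw [antipode_comul]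
    _ = _ := by rw [hlam, hs, unit_antipodeInv]

/-- The key property `y₁ λ(y₂ S(x)) = λ(y S(x₁)) x₂` of an integral form `λ`. -/
theorem integral_exchange {lam : BTerm G 1 0}
    (hlam : ∀ i x, 𝐝 i (lay R lam (i + 1) x) = lay R lam i (𝐮 i x)) (i : ℕ)
    (x : PresObj.Germ R) :
    𝐝 i (𝐬 (i + 2) (𝐦 (i + 1) (lay R lam (i + 1) x))) =
      𝐝 (i + 1) (𝐬 (i + 1) (𝐦 i (lay R lam i x))) := by
  -- Bundling λ ∘ μ lets it slide across a strand as one form.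
  have hκ : ∀ i x, lay R (lam ⊚ A.mul) i x = 𝐦 i (lay R lam i x) := fun i x => by rw [lay_comp]
  symm
  calc 𝐝 (i + 1) (𝐬 (i + 1) (𝐦 i (lay R lam i x)))
    -- With z = yS(x₁), the scalar λ(z) is expanded as z₁λ(z₂). As S reverses the coproduct, z₁ =
    -- y₁S(x₂), which cancels against x₃.
    _ = 𝐝 (i + 1) (𝐬 (i + 1) (𝐦 i (𝐝 i (lay R lam (i + 1) (𝐦 i x))))) := by
      rw [hlam, unit_mul]
    _ = 𝐝 (i + 1) (𝐬 (i + 1) (𝐝 i (𝐝 (i + 2) (𝐜 (i + 1) (𝐦 i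
          (lay R (lam ⊚ A.mul) (i + 1) (𝐦 i x))))))) := by
      rw [mul_comul, hκ]
    _ = 𝐝 (i + 1) (𝐝 i (𝐬 (i + 2) (𝐝 (i + 2) (𝐜 (i + 1) (𝐦 i
          (lay R (lam ⊚ A.mul) (i + 1) (𝐦 i x))))))) := by
      simp
    _ = 𝐝 (i + 1) (𝐝 i (𝐝 (i + 2) (𝐜 (i + 2) (𝐬 (i + 2) (𝐬 (i + 3) (𝐜 (i + 1) (𝐦 i
          (𝐜 (i + 1 + 1) (𝐜 (i + 1) (lay R (lam ⊚ A.mul) (i + 1 + 1) (𝐦 i x))))))))))) := by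
      rw [antipode_comul, strand_right₂₀]
    _ = 𝐝 (i + 1) (𝐝 i (𝐝 (i + 2) (𝐬 (i + 3) (𝐜 (i + 2) (𝐜 (i + 1) (𝐜 (i + 3) (𝐜 (i + 2)
          (𝐦 (i + 1) (𝐬 (i + 3) (lay R (lam ⊚ A.mul) (i + 2) (𝐦 i x))))))))))) := by
      simp [strand_left₁₁, strand_right₁₁, mul_assoc, Nat.add_assoc]
    _ = 𝐝 (i + 1) (𝐝 i (𝐝 (i + 2) (𝐬 (i + 3) (𝐦 (i + 2 + 1) (𝐜 (i + 2) (𝐜 (i + 1)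
          (𝐬 (i + 3) (lay R (lam ⊚ A.mul) (i + 2) (𝐦 i x))))))))) := by
      rw [strand_left₂₁, strand_left₂₁]
      simp [Nat.add_assoc]
    _ = 𝐝 i (𝐝 (i + 2) (𝐝 (i + 2 + 1) (𝐬 (i + 2 + 1) (𝐦 (i + 2 + 1) (𝐜 (i + 2) (𝐜 (i + 1)
          (𝐬 (i + 3) (lay R (lam ⊚ A.mul) (i + 2) (𝐦 i x))))))))) := by
      rw [← comul_assoc]
      simp [Nat.add_assoc]
    _ = 𝐝 i (𝐮 (i + 1) (𝐬 (i + 3) (lay R (lam ⊚ A.mul) (i + 2) (𝐦 i x)))) := by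
      rw [antipode_left, comul_counit, strand_left₀₁, strand_left₀₁]
    _ = 𝐝 i (𝐮 (i + 1) (𝐦 i (𝐬 (i + 2) (lay R (lam ⊚ A.mul) (i + 1) x)))) := by
      simp
    _ = _ := by rw [mul_unit, hκ]

variable (A) in
/-- The linear form `lam` and the element `Lam` are two-sided integrals of `A`, with `Lam` the
image of `lam` under the copairing. -/
structure IsIntegral (lam : BTerm G 1 0) (Lam : BTerm G 0 1) : Prop where
  comul : ∀ i x, 𝐝 i (lay R lam (i + 1) x) = lay R lam i (𝐮 i x)
  mul : ∀ i x, lay R Lam i (𝐦 i x) = 𝐞 i (lay R Lam i x)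
  form_antipode : ∀ i x, 𝐬 i (lay R lam i x) = lay R lam i x
  element_antipode : ∀ i x, lay R Lam i (𝐬 i x) = lay R Lam i x
  copairing : ∀ i x, 𝐰 i (lay R lam i x) = lay R Lam i x

variable (A) in
/-- The pairing `y ⊗ x ↦ λ(w' S(x)) λ(w'' y)`. -/
def pairing (lam : BTerm G 1 0) : BTerm G 2 0 :=
  lam ⊚ A.mul ⊚ (.id 1 ⊠ (lam ⊚ A.mul) ⊠ A.antipode) ⊚ (A.w ⊠ .id 2)

theorem lay_pairing (lam : BTerm G 1 0) (i : ℕ) (x : PresObj.Germ R) :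
    lay R (A.pairing lam) i x =
      𝐰 i (𝐦 (i + 1) (lay R lam (i + 1) (𝐬 (i + 1) (𝐦 i (lay R lam i x))))) := by
  simp only [pairing, lay_comp, lay_tensor, lay_id, Nat.add_zero]

namespace IsIntegral

variable {lam : BTerm G 1 0} {Lam : BTerm G 0 1} (i : ℕ) (x : PresObj.Germ R)

local notation "𝐈" => lay R lam
local notation "𝚲" => lay R Lam

theorem copairing_right (h : A.IsIntegral lam Lam) : 𝐰 i (𝐈 (i + 1) x) = 𝚲 i x := by
  rw [← copairing_flip, h.form_antipode, lay_comm_zero_add _ _ le_rfl, strand_right₁₀, h.copairing,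
    h.element_antipode]

/-- Here λ(Λ) is not assumed to be 1. The statement therefore also applies to integrals obtained
from a pairing, where it serves to prove the normalization. -/
theorem zigzag (h : A.IsIntegral lam Lam) :
    𝐰 i (lay R (A.pairing lam) (i + 1) x) = 𝚲 i (𝐈 i x) := by
  rw [lay_pairing]
  calc _ = 𝐰 i (𝐰 (i + 1) (𝐦 (i + 2) (𝐬 (i + 3) (𝐈 (i + 2) (𝐦 (i + 1) (𝐈 (i + 1) x)))))) := by
        simp [Nat.add_assoc]
    _ = 𝐰 i (𝐈 (i + 1) (𝐝 i (𝐬 (i + 2) (𝐦 (i + 1) (𝐈 (i + 1) x))))) := by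
        rw [← copairing_comul_left]; simp [Nat.add_assoc]
    _ = 𝚲 i (𝐝 (i + 1) (𝐬 (i + 1) (𝐦 i (𝐈 i x)))) := by
        rw [h.copairing_right, integral_exchange h.comul]
    _ = 𝐝 i (𝐬 i (𝚲 i (𝐦 i (𝐈 i x)))) := by simp
    _ = _ := by rw [h.mul, antipode_counit, counit_comul]

theorem isPairing (h : A.IsIntegral lam Lam) (h₁ : ∀ i x, 𝚲 i (𝐈 i x) = x) :
    A.IsPairing (A.pairing lam) :=
  .of_left fun i x => by rw [h.zigzag, h₁]

/-- Of the three copies of v₊, two turn w into Δ(v₊); then λ(v₁)v₂ = λ(v₊)1 = 1 leaves λ(v₊) = 1. -/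
theorem pairing_ribbon (h : A.IsIntegral lam Lam) (hv : ∀ i x, 𝐯 i (𝐈 i x) = x) :
    𝐯 i (𝐯 (i + 1) (𝐦 i (𝐯 (i + 1) (lay R (A.pairing lam) i x)))) = x := by
  rw [lay_pairing]
  calc _ = 𝐰 i (𝐯 (i + 2) (𝐯 (i + 3) (𝐦 (i + 1 + 1) (𝐦 (i + 1) (𝐈 (i + 1) (𝐯 (i + 1)
          (𝐦 i (𝐈 i x)))))))) := by
        simp [Nat.add_assoc]
    _ = 𝐰 i (𝐯 (i + 2) (𝐯 (i + 3) (𝐦 (i + 1) (𝐦 (i + 1) (𝐈 (i + 1) (𝐯 (i + 1)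
          (𝐦 i (𝐈 i x)))))))) := by
        rw [← A.mul_assoc (i + 1)]
    _ = 𝐰 i (𝐯 (i + 1 + 1) (𝐦 (i + 1) (𝐯 (i + 1 + 1) (𝐦 (i + 1) (𝐈 (i + 1) (𝐯 (i + 1)
          (𝐦 i (𝐈 i x)))))))) := by
        simp [Nat.add_assoc]
    _ = 𝐰 i (𝐭 (i + 1) (𝐭 (i + 1) (𝐈 (i + 1) (𝐭 i (𝐈 i x))))) := by
        rw [← tp_eq', ← tp_eq', ← tp_eq']
    _ = 𝐰 i (𝐭 i (𝐭 (i + 1) (𝐈 i (𝐭 i (𝐈 i x))))) := by simp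
    _ = 𝐯 i (𝐈 i (𝐮 i (𝐭 i (𝐈 i x)))) := by
        rw [← ribbon_comul, comul_left_of_comul_right h.comul h.form_antipode]
    _ = x := by rw [hv, unit_tp, hv]

variable {b : BTerm G 2 0}

theorem form_eq (h : A.IsIntegral lam Lam) (hv : ∀ i x, 𝐯 i (𝐈 i x) = x)
    (hb : A.IsPairing b) : 𝐯⁻ i (𝐭⁻ (i + 1) (lay R b i x)) = 𝐈 i x := by
  -- λ(v₊w′)w″ = v₋, since Δ(v₊) = w · (v₊ ⊗ v₊) and λ(v₁)v₂ = 1.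
  have h₁ : ∀ x, 𝐰 i (𝐭 i (𝐈 i x)) = 𝐯⁻ i x := fun x => by
    calc _ = 𝐰 i (𝐭 i (𝐭 (i + 1) (𝐈 i (𝐭⁻ i x)))) := by simp
      _ = _ := by
        rw [← ribbon_comul, comul_left_of_comul_right h.comul h.form_antipode, hv, unit_tm]
  calc _ = 𝐰 i (𝐭 i (𝐈 i (𝐭⁻ (i + 1) (lay R b i x)))) := by rw [h₁]
    _ = 𝐭⁻ i (𝐰 i (lay R b (i + 1) (𝐭 i (𝐈 i x)))) := by simp
    _ = _ := by rw [hb.left, tm_tp]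

/-- The normalization of the integrals follows from that of the pairing. -/
theorem element_form (h : A.IsIntegral lam Lam) (hv : ∀ i x, 𝐯 i (𝐈 i x) = x)
    (hb : A.IsPairing b)
    (hbv : ∀ i x, 𝐯 i (𝐯 (i + 1) (𝐦 i (𝐯 (i + 1) (lay R b i x)))) = x) : 𝚲 i (𝐈 i x) = x := by
  -- Composing the zigzag with b shows that the pairing built from λ is λ(Λ) · b.
  have h₁ : ∀ x, lay R (A.pairing lam) i x = 𝚲 i (𝐈 i (lay R b i x)) := fun x => by
    calc _ = 𝐰 (i + 1) (lay R b i (lay R (A.pairing lam) i x)) := by rw [hb.right]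
      _ = 𝐰 (i + 1) (lay R (A.pairing lam) (i + 1 + 1) (lay R b i x)) := by simp [Nat.add_assoc]
      _ = _ := by rw [h.zigzag, ← lay_comp, lay_scalar, lay_comp]
  -- As an endomorphism of the unit, λ ∘ Λ moves past every other layer.
  have h₂ : ∀ x, 𝚲 i (𝐈 i x) = lay R (lam ⊚ Lam) i x := fun x => by rw [lay_comp]
  calc 𝚲 i (𝐈 i x)
    _ = lay R (lam ⊚ Lam) i (𝐯 i (𝐯 (i + 1) (𝐦 i (𝐯 (i + 1) (lay R b i x))))) := by rw [h₂, hbv]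
    _ = 𝐯 i (𝐯 (i + 1) (𝐦 i (𝐯 (i + 1) (lay R (lam ⊚ Lam) i (lay R b i x))))) := by
      rw [lay_comm_zero _ A.vp, lay_comm_zero_add _ A.vp (Nat.zero_le 1), lay_comm_zero _ A.mul,
        lay_comm_zero_add _ A.vp (Nat.zero_le 1)]
      rfl
    _ = x := by rw [← h₂, ← h₁, h.pairing_ribbon _ _ hv]

end IsIntegral

/-!
### The integrals defined by a pairing
-/

variable (A) in
/-- The linear form `x ↦ b(v₋, v₋ x)`. -/
def form (b : BTerm G 2 0) : BTerm G 1 0 := b ⊚ (A.vm ⊠ A.tm)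

variable (A) in
/-- The element `λ(w') w''`. -/
def element (lam : BTerm G 1 0) : BTerm G 0 1 := (lam ⊠ .id 1) ⊚ A.w

theorem lay_form (b : BTerm G 2 0) (i : ℕ) (x : PresObj.Germ R) :
    lay R (A.form b) i x = 𝐯⁻ i (𝐭⁻ (i + 1) (lay R b i x)) := by
  simp only [form, lay_comp, lay_tensor]

theorem lay_element (lam : BTerm G 1 0) (i : ℕ) (x : PresObj.Germ R) :
    lay R (A.element lam) i x = 𝐰 i (lay R lam i x) := by
  simp only [element, lay_comp, lay_tensor, lay_id]

namespace IsPairing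

variable {b : BTerm G 2 0} (i : ℕ) (x : PresObj.Germ R)

local notation "𝐛" => lay R b
local notation "𝐈" => lay R (RibbonHopf.form A b)

theorem ribbon_form (hb : A.IsPairing b) : 𝐯 i (𝐈 i x) = x := by
  rw [lay_form]
  calc _ = 𝐯⁻ i (𝐯 (i + 1) (𝐭⁻ (i + 1) (𝐛 i x))) := by simp
    _ = x := by rw [ribbon_tm, hb.unit_right, ribbonInv_counit]

theorem form_antipode (hb : A.IsPairing b) : 𝐬 i (𝐈 i x) = 𝐈 i x := by
  rw [lay_form]
  calc _ = 𝐯⁻ i (𝐬 (i + 1) (𝐭⁻ (i + 1) (𝐛 i x))) := by simp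
    _ = 𝐯⁻ i (𝐭⁻ (i + 1) (𝐬 i (𝐛 i x))) := by rw [← tm_antipode, ← hb.antipode]
    _ = 𝐯⁻ i (𝐬 i (𝐭⁻ (i + 1) (𝐛 i x))) := by simp
    _ = _ := by rw [ribbonInv_antipode]

/-- Since v₋v₁ ⊗ v₂ = w′ ⊗ w″v₊, the form gives w̄(v₋ ⊗ w′)w″v₊ = v₋v₊ = 1. -/
theorem ribbon_comul_form (hb : A.IsPairing b) : 𝐯 i (𝐝 i (𝐈 i x)) = 𝐮 i x := by
  rw [lay_form]
  calc _ = 𝐯⁻ i (𝐯 (i + 1) (𝐝 (i + 1) (𝐭⁻ (i + 1) (𝐛 i x)))) := by simp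
    _ = 𝐯⁻ i (𝐰 (i + 1) (𝐭 (i + 2) (𝐛 i x))) := by rw [ribbon_comul]; simp [Nat.add_assoc]
    _ = 𝐯⁻ i (𝐰 (i + 1) (𝐛 i (𝐭 i x))) := by simp
    _ = _ := by rw [hb.right, ribbonInv_tp]

/-- A second expression for T(y) = v₁ w̄(v₂ ⊗ y), namely v₊y₁ w̄(v₊ ⊗ y₂), used to invert T. -/
theorem ribbon_comul_pairing (hb : A.IsPairing b) :
    𝐯 i (𝐝 i (𝐛 (i + 1) x)) = 𝐝 i (𝐭 i (𝐯 (i + 1) (𝐛 (i + 1) x))) := by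
  calc 𝐯 i (𝐝 i (𝐛 (i + 1) x))
    _ = 𝐰 i (𝐭 i (𝐯 (i + 1) (𝐝 (i + 1 + 2) (𝐛 (i + 1 + 1) (𝐛 (i + 1) x))))) := by
      rw [ribbon_comul, tp_eq _ (i + 1), hb.mul_left]
    _ = 𝐝 i (𝐰 i (𝐛 (i + 1) (𝐭 i (𝐯 (i + 1) (𝐛 (i + 1) x))))) := by simp [Nat.add_assoc]
    _ = _ := by rw [hb.left]

/-- A right inverse of T: the factors w̄(v₊ ⊗ ·) and w̄(v₋ ⊗ ·) combine by `mul_left` into w̄(1 ⊗ ·)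
= ε. -/
theorem ribbonInv_comul_pairing (hb : A.IsPairing b) :
    𝐭⁻ i (𝐝 i (𝐯⁻ (i + 1) (𝐛 (i + 1) (𝐯 i (𝐝 i (𝐛 (i + 1) x)))))) = x := by
  rw [hb.ribbon_comul_pairing]
  calc _ = 𝐭⁻ i (𝐝 i (𝐝 i (𝐯 (i + 1) (𝐛 (i + 1) (𝐯⁻ (i + 1) (𝐛 (i + 1) (𝐭 i x))))))) := by
        simp [Nat.add_assoc]
    _ = 𝐭⁻ i (𝐝 i (𝐯⁻ (i + 1) (𝐯 (i + 1 + 1) (𝐝 (i + 1 + 2) (𝐛 (i + 1 + 1) (𝐛 (i + 1)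
          (𝐭 i x))))))) := by
        rw [comul_assoc]
        simp [Nat.add_assoc]
    _ = _ := by
        rw [← hb.mul_left, ribbonInv_ribbon, hb.unit_left, comul_counit, tm_tp]

theorem comul_form (hb : A.IsPairing b) : 𝐝 i (𝐈 i x) = 𝐈 i (𝐮 i x) := by
  -- After T, both sides of the integral equation become y ↦ ε(y)1, because λ(v₁)v₂ = 1; the right
  -- inverse of T then cancels it.
  have h₁ : 𝐯 i (𝐝 i (𝐛 (i + 1) (𝐝 i (𝐈 i x)))) = 𝐞 i (𝐮 i x) := by
    calc _ = 𝐯 i (𝐝 i (𝐝 i (𝐛 (i + 2) (𝐈 i x)))) := by simp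
      _ = 𝐯 i (𝐝 i (𝐝 (i + 1) (𝐈 i (𝐛 (i + 1) x)))) := by rw [comul_assoc]; simp
      _ = 𝐯 i (𝐝 i (𝐈 i (𝐝 i (𝐛 (i + 1) x)))) := by simp
      _ = _ := by
          rw [hb.ribbon_comul_form, unit_comul, hb.unit_left]; simp
  have h₂ : 𝐯 i (𝐝 i (𝐛 (i + 1) (𝐈 i (𝐮 i x)))) = 𝐞 i (𝐮 i x) := by
    calc _ = 𝐯 i (𝐝 i (𝐈 i (𝐛 i (𝐮 i x)))) := by rw [lay_comm_zero (A.form b) b]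
      _ = _ := by rw [hb.ribbon_comul_form, hb.unit_left]
  rw [← hb.ribbonInv_comul_pairing i (𝐝 i (𝐈 i x)), h₁, ← h₂, hb.ribbonInv_comul_pairing]

/-- A pairing inverse to the copairing defines integrals. -/
theorem isIntegral (hb : A.IsPairing b) : A.IsIntegral (A.form b) (A.element (A.form b)) where
  comul := comul_right_of_comul_left hb.comul_form hb.form_antipode
  form_antipode := hb.form_antipode
  copairing i x := (lay_element _ _ _).symm
  element_antipode i x := by
    rw [lay_element, lay_element]
    calc _ = 𝐰 i (𝐬 (i + 1) (𝐈 i x)) := by simp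
      _ = _ := by rw [← copairing_antipode, hb.form_antipode]
  mul i x := by
    -- As w̄(Λ ⊗ ·) = λ, `mul_left` gives w̄(Λy ⊗ z) = w̄(y ⊗ z₁)λ(z₂) = ε(y)λ(z), and nondegeneracy
    -- gives Λy = ε(y)Λ.
    have h₁ : ∀ x, lay R (A.element (A.form b)) i (𝐛 i x) = 𝐈 i x := fun x => by
      rw [lay_element]
      calc _ = 𝐰 i (𝐛 (i + 1) (𝐈 i x)) := by simp
        _ = _ := hb.left _ _
    calc lay R (A.element (A.form b)) i (𝐦 i x)
      _ = lay R (A.element (A.form b)) i (𝐦 i (𝐰 (i + 1) (𝐛 i x))) := by rw [hb.right]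
      _ = 𝐰 (i + 1) (lay R (A.element (A.form b)) i (𝐦 i (𝐛 i x))) := by simp
      _ = 𝐰 (i + 1) (𝐝 (i + 1) (𝐛 i (lay R (A.element (A.form b)) i (𝐛 i x)))) := by
        rw [hb.mul_left]; simp
      _ = 𝐰 (i + 1) (𝐝 (i + 1) (𝐈 (i + 1 + 1) (𝐛 i x))) := by
        rw [h₁]; simp [Nat.add_assoc]
      _ = 𝐰 (i + 1) (𝐈 (i + 1) (𝐞 i x)) := by
        rw [comul_right_of_comul_left hb.comul_form hb.form_antipode, hb.unit_right]
      _ = 𝐞 i (lay R (A.element (A.form b)) i x) := by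
        rw [← lay_element]; simp

end IsPairing

end RibbonHopf

/-!
### Functors defined on generators
-/

namespace BTerm

variable {G G' : ℕ → ℕ → Type}

/-- Substitution of expressions for generators. -/
def bind (φ : ∀ ⦃m n : ℕ⦄, G m n → BTerm G' m n) : ∀ {m n : ℕ}, BTerm G m n → BTerm G' m n
  | _, _, .gen x => φ x
  | _, _, .id n => .id n
  | _, _, .comp g f => bind φ g ⊚ bind φ f
  | _, _, .tensor f g => bind φ f ⊠ bind φ g
  | _, _, .braid m n => .braid m n
  | _, _, .braidInv m n => .braidInv m n

variable (φ : ∀ ⦃m n : ℕ⦄, G m n → BTerm G' m n)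

theorem bind_cast {m n : ℕ} (h : m = n) : bind φ (cast h : BTerm G m n) = cast h := by
  subst h; rfl

variable {R : ∀ ⦃m n : ℕ⦄, BTerm G m n → BTerm G m n → Prop}
  {R' : ∀ ⦃m n : ℕ⦄, BTerm G' m n → BTerm G' m n → Prop}

theorem Congr.bind {φ : ∀ ⦃m n : ℕ⦄, G m n → BTerm G' m n}
    (hφ : ∀ ⦃m n : ℕ⦄ (f g : BTerm G m n), R f g → Congr R' (bind φ f) (bind φ g))
    {m n : ℕ} {f g : BTerm G m n} (h : Congr R f g) :
    Congr R' (BTerm.bind φ f) (BTerm.bind φ g) := by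
  induction h with
  | ax h => exact hφ _ _ h
  | refl => exact .refl _
  | symm _ ih => exact .symm ih
  | trans _ _ ih ih' => exact .trans ih ih'
  | comp_congr _ _ ih ih' => exact .comp_congr ih ih'
  | tensor_congr _ _ ih ih' => exact .tensor_congr ih ih'
  | id_comp => exact .id_comp _
  | comp_id => exact .comp_id _
  | comp_assoc => exact .comp_assoc _ _ _
  | tensor_id => exact .tensor_id _ _
  | tensor_comp => exact .tensor_comp _ _ _ _
  | tensor_assoc => simp only [BTerm.bind, bind_cast]; exact .tensor_assoc _ _ _
  | unit_tensor => simp only [BTerm.bind, bind_cast]; exact .unit_tensor _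
  | tensor_unit => simp only [BTerm.bind, bind_cast]; exact .tensor_unit _
  | braidInv_braid => exact .braidInv_braid _ _
  | braid_braidInv => exact .braid_braidInv _ _
  | braid_naturality => exact .braid_naturality _ _
  | braid_tensor_left => simp only [BTerm.bind, bind_cast]; exact .braid_tensor_left _ _ _
  | braid_tensor_right => simp only [BTerm.bind, bind_cast]; exact .braid_tensor_right _ _ _

theorem Congr.bind_bind {φ : ∀ ⦃m n : ℕ⦄, G m n → BTerm G' m n}
    {ψ : ∀ ⦃m n : ℕ⦄, G' m n → BTerm G m n}
    (h : ∀ ⦃m n : ℕ⦄ (x : G m n), Congr R (BTerm.bind ψ (φ x)) (.gen x)) {m n : ℕ}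
    (t : BTerm G m n) : Congr R (BTerm.bind ψ (BTerm.bind φ t)) t := by
  induction t with
  | gen x => exact h x
  | id => exact .refl _
  | comp g f ihg ihf => exact .comp_congr ihg ihf
  | tensor f g ihf ihg => exact .tensor_congr ihf ihg
  | braid => exact .refl _
  | braidInv => exact .refl _

end BTerm

namespace PresObj

variable {G G' : ℕ → ℕ → Type} {R : ∀ ⦃m n : ℕ⦄, BTerm G m n → BTerm G m n → Prop}
  {R' : ∀ ⦃m n : ℕ⦄, BTerm G' m n → BTerm G' m n → Prop}

/-- The functor which substitutes expressions for generators. -/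
def functor (φ : ∀ ⦃m n : ℕ⦄, G m n → BTerm G' m n)
    (hφ : ∀ ⦃m n : ℕ⦄ (f g : BTerm G m n), R f g → BTerm.Congr R' (f.bind φ) (g.bind φ)) :
    PresObj R ⥤ PresObj R' where
  obj X := ⟨X.size⟩
  map f := Quotient.map (BTerm.bind φ) (fun _ _ h => BTerm.Congr.bind hφ h) f
  map_id _ := rfl
  map_comp f g := by
    induction f using Quotient.inductionOn
    induction g using Quotient.inductionOn
    rfl

variable (φ : ∀ ⦃m n : ℕ⦄, G m n → BTerm G' m n)
  (hφ : ∀ ⦃m n : ℕ⦄ (f g : BTerm G m n), R f g → BTerm.Congr R' (f.bind φ) (g.bind φ))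

theorem functor_map_castIso {m n : ℕ} (h : m = n) :
    (functor φ hφ).map (castIso R h).hom = (castIso R' h).hom := by
  subst h; rfl

theorem functor_map_tensorHom {X Y X' Y' : PresObj R} (f : X ⟶ Y) (g : X' ⟶ Y') :
    (functor φ hφ).map (f ⊗ₘ g) = (functor φ hφ).map f ⊗ₘ (functor φ hφ).map g := by
  induction f using Quotient.inductionOn
  induction g using Quotient.inductionOn
  rfl

/-- Taking the identities as hypotheses allows structure maps that are identities only up to
unfolding to be removed without syntactic rewriting. -/
theorem id_comp_id_comp {X Y : PresObj R} {f g : X ⟶ X} {h : X ⟶ Y} (hf : f = 𝟙 X)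
    (hg : g = 𝟙 X) : f ≫ g ≫ h = h := by
  rw [hf, hg, Category.id_comp, Category.id_comp]

theorem comp_id_comp_id {X Y : PresObj R} {f g : Y ⟶ Y} {h : X ⟶ Y} (hf : f = 𝟙 Y)
    (hg : g = 𝟙 Y) : h ≫ g ≫ f = h := by
  rw [hf, hg, Category.comp_id, Category.comp_id]

/-- Substitution of expressions for generators is a strict braided monoidal functor. -/
def functorCoreMonoidal : (functor φ hφ).CoreMonoidal where
  εIso := Iso.refl _
  μIso X Y := Iso.refl _
  μIso_hom_natural_left f X' := by
    refine (Category.comp_id _).trans (Eq.trans ?_ (Category.id_comp _).symm)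
    exact (functor_map_tensorHom φ hφ f (𝟙 X')).symm
  μIso_hom_natural_right X' f := by
    refine (Category.comp_id _).trans (Eq.trans ?_ (Category.id_comp _).symm)
    exact (functor_map_tensorHom φ hφ (𝟙 X') f).symm
  associativity X Y Z := by
    refine (id_comp_id_comp (id_whiskerRight _ _) rfl).trans ?_
    refine (functor_map_castIso φ hφ (Nat.add_assoc X.size Y.size Z.size)).trans ?_
    symm
    exact comp_id_comp_id (h := (α_ ((functor φ hφ).obj X) ((functor φ hφ).obj Y)
      ((functor φ hφ).obj Z)).hom) rfl (MonoidalCategory.whiskerLeft_id _ _)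
  left_unitality X := by
    symm
    exact (id_comp_id_comp (id_whiskerRight _ _) rfl).trans
      (functor_map_castIso φ hφ (Nat.zero_add X.size))
  right_unitality X := by
    symm
    exact (id_comp_id_comp (MonoidalCategory.whiskerLeft_id _ _) rfl).trans
      (functor_map_castIso φ hφ (Nat.add_zero X.size))

instance : (functor φ hφ).Monoidal := (functorCoreMonoidal φ hφ).toMonoidal

theorem functor_μ (X Y : PresObj R) : Functor.LaxMonoidal.μ (functor φ hφ) X Y =
    𝟙 ((functor φ hφ).obj X ⊗ (functor φ hφ).obj Y) := rfl

instance : (functor φ hφ).Braided where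
  braided X Y := by
    rw [functor_μ, functor_μ]
    exact (Category.id_comp _).trans (Category.comp_id _).symm

/-- Substitutions which are inverse to each other on generators define equivalences. -/
theorem functor_isEquivalence {ψ : ∀ ⦃m n : ℕ⦄, G' m n → BTerm G m n}
    (hψ : ∀ ⦃m n : ℕ⦄ (f g : BTerm G' m n), R' f g → BTerm.Congr R (f.bind ψ) (g.bind ψ))
    (hφψ : ∀ ⦃m n : ℕ⦄ (x : G m n), BTerm.Congr R ((φ x).bind ψ) (.gen x))
    (hψφ : ∀ ⦃m n : ℕ⦄ (x : G' m n), BTerm.Congr R' ((ψ x).bind φ) (.gen x)) :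
    (functor φ hφ).IsEquivalence :=
  (CategoryTheory.Equivalence.mk (functor φ hφ) (functor ψ hψ)
    (NatIso.ofComponents (fun X => Iso.refl X) fun {X Y} f => by
      induction f using Quotient.inductionOn with | _ t
      refine (Category.comp_id _).trans (Eq.trans ?_ (Category.id_comp _).symm)
      exact (homMk_eq (BTerm.Congr.bind_bind hφψ t)).symm)
    (NatIso.ofComponents (fun X => Iso.refl X) fun {X Y} f => by
      induction f using Quotient.inductionOn with | _ t
      refine (Category.comp_id _).trans (Eq.trans ?_ (Category.id_comp _).symm)
      exact homMk_eq (BTerm.Congr.bind_bind hψφ t))).isEquivalence_functor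

end PresObj

/-!
### Kerler and Habiro Hopf algebras
-/

open BTerm

/-- The Kerler Hopf algebra structure of the generating object of `3Alg^K`, without integrals. -/
def Kerler.ribbonHopf : RibbonHopf Kerler.Rel where
  toHopfTerms := Kerler.terms
  w := Kerler.w
  vp := Kerler.vp
  vm := Kerler.vm
  hopf _ _ _ _ h := .hopf h
  ribbon _ _ _ _ h := .ribbon h

/-- The Habiro Hopf algebra structure of the generating object of `3Alg^H`, without pairing. -/
def Habiro.ribbonHopf : RibbonHopf Habiro.Rel where
  toHopfTerms := Habiro.terms
  w := Habiro.w
  vp := Habiro.vp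
  vm := Habiro.vm
  hopf _ _ _ _ h := .hopf h
  ribbon _ _ _ _ h := .ribbon h

namespace Kerler

theorem lay_rel {a b : ℕ} {s t : BTerm KerlerGen a b} (h : Rel s t) (i : ℕ)
    (x : PresObj.Germ Rel) : lay Rel s i x = lay Rel t i x := (Congr.ax h).lay_eq i x

theorem isIntegral : ribbonHopf.IsIntegral lam Lam where
  comul i x := by
    have h := lay_rel .comul_integralForm i x
    simp only [lay_comp, lay_tensor, lay_id] at h
    exact h
  mul i x := by
    have h := lay_rel .integralElement_mul i x
    simp only [lay_comp, lay_tensor, lay_id] at h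
    exact h
  form_antipode i x := by
    have h := lay_rel .integralForm_antipode i x
    simp only [lay_comp] at h
    exact h
  element_antipode i x := by
    have h := lay_rel .antipode_integralElement i x
    simp only [lay_comp] at h
    exact h
  copairing i x := by
    have h := lay_rel .integralForm_copairing i x
    simp only [lay_comp, lay_tensor, lay_id] at h
    exact h

theorem lay_Lam_lam (i : ℕ) (x : PresObj.Germ Rel) : lay Rel Lam i (lay Rel lam i x) = x := by
    have h := lay_rel .integralForm_integralElement i x
    simp only [lay_comp, lay_id] at h
    exact h

theorem lay_vp_lam (i : ℕ) (x : PresObj.Germ Rel) : lay Rel vp i (lay Rel lam i x) = x := by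
    have h := lay_rel .integralForm_ribbon i x
    simp only [lay_comp, lay_id] at h
    exact h

theorem isPairing : ribbonHopf.IsPairing (ribbonHopf.pairing lam) :=
  isIntegral.isPairing lay_Lam_lam

end Kerler

namespace Habiro

theorem lay_rel {a b : ℕ} {s t : BTerm HabiroGen a b} (h : Rel s t) (i : ℕ)
    (x : PresObj.Germ Rel) : lay Rel s i x = lay Rel t i x := (Congr.ax h).lay_eq i x

theorem isPairing : ribbonHopf.IsPairing wbar where
  left i x := by
    have h := lay_rel .zigzag_left i x
    simp only [lay_comp, lay_tensor, lay_id] at h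
    exact h
  right i x := by
    have h := lay_rel .zigzag_right i x
    simp only [lay_comp, lay_tensor, lay_id] at h
    exact h

theorem lay_pairing_ribbon (i : ℕ) (x : PresObj.Germ Rel) :
    lay Rel vp i (lay Rel vp (i + 1) (lay Rel terms.mul i (lay Rel vp (i + 1)
      (lay Rel wbar i x)))) = x := by
    have h := lay_rel .pairing_ribbon i x
    simp only [lay_comp, lay_tensor, lay_id] at h
    exact h

end Habiro

/-! ### The mutually inverse substitutions -/

/-- The structure morphisms of a Kerler Hopf algebra, in terms of those of a Habiro Hopf
algebra. -/
def kerlerToHabiro : ∀ ⦃m n : ℕ⦄, KerlerGen m n → BTerm HabiroGen m n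
  | _, _, .hopf x => .gen (.hopf x)
  | _, _, .integralForm => Habiro.ribbonHopf.form Habiro.wbar
  | _, _, .integralElement => Habiro.ribbonHopf.element (Habiro.ribbonHopf.form Habiro.wbar)
  | _, _, .copairing => Habiro.w
  | _, _, .ribbon => Habiro.vp
  | _, _, .ribbonInv => Habiro.vm

/-- The structure morphisms of a Habiro Hopf algebra, in terms of those of a Kerler Hopf
algebra. -/
def habiroToKerler : ∀ ⦃m n : ℕ⦄, HabiroGen m n → BTerm KerlerGen m n
  | _, _, .hopf x => .gen (.hopf x)
  | _, _, .copairing => Kerler.w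
  | _, _, .pairing => Kerler.ribbonHopf.pairing Kerler.lam
  | _, _, .ribbon => Kerler.vp
  | _, _, .ribbonInv => Kerler.vm

theorem congr_kerlerToHabiro ⦃m n : ℕ⦄ (f g : BTerm KerlerGen m n) (h : Kerler.Rel f g) :
    Congr Habiro.Rel (f.bind kerlerToHabiro) (g.bind kerlerToHabiro) := by
  have hI := Habiro.isPairing.isIntegral
  have hΛ := fun i x => hI.element_form i x (fun i x => Habiro.isPairing.ribbon_form i x)
    Habiro.isPairing Habiro.lay_pairing_ribbon
  cases h with
  -- Common generators go to themselves, so each common axiom goes to the axiom of the same name.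
  | hopf h => exact .ax (.hopf (by cases h <;> constructor))
  | ad_cocomm h => exact .ax (.ad_cocomm (by cases h; constructor))
  | ribbon h => exact .ax (.ribbon (by cases h <;> constructor))
  | comul_integralForm =>
    refine Habiro.ribbonHopf.congr_of_lay fun x => ?_
    simp only [BTerm.bind, lay_comp, lay_tensor, lay_id]
    exact hI.comul 0 x
  | integralElement_mul =>
    refine Habiro.ribbonHopf.congr_of_lay fun x => ?_
    simp only [BTerm.bind, lay_comp, lay_tensor, lay_id]
    exact hI.mul 0 x
  | integralForm_integralElement =>
    refine Habiro.ribbonHopf.congr_of_lay fun x => ?_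
    simp only [BTerm.bind, lay_comp, lay_id]
    exact hΛ 0 x
  | antipode_integralElement =>
    refine Habiro.ribbonHopf.congr_of_lay fun x => ?_
    simp only [BTerm.bind, lay_comp]
    exact hI.element_antipode 0 x
  | integralForm_antipode =>
    refine Habiro.ribbonHopf.congr_of_lay fun x => ?_
    simp only [BTerm.bind, lay_comp]
    exact hI.form_antipode 0 x
  | integralForm_copairing =>
    refine Habiro.ribbonHopf.congr_of_lay fun x => ?_
    simp only [BTerm.bind, lay_comp, lay_tensor, lay_id]
    exact hI.copairing 0 x
  | integralForm_ribbon =>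
    refine Habiro.ribbonHopf.congr_of_lay fun x => ?_
    simp only [BTerm.bind, lay_comp, lay_id]
    exact Habiro.isPairing.ribbon_form 0 x

theorem congr_habiroToKerler ⦃m n : ℕ⦄ (f g : BTerm HabiroGen m n) (h : Habiro.Rel f g) :
    Congr Kerler.Rel (f.bind habiroToKerler) (g.bind habiroToKerler) := by
  cases h with
  | hopf h => exact .ax (.hopf (by cases h <;> constructor))
  | ad_cocomm h => exact .ax (.ad_cocomm (by cases h; constructor))
  | ribbon h => exact .ax (.ribbon (by cases h <;> constructor))
  | zigzag_left =>
    refine Kerler.ribbonHopf.congr_of_lay fun x => ?_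
    simp only [BTerm.bind, lay_comp, lay_tensor, lay_id]
    exact Kerler.isPairing.left 0 x
  | zigzag_right =>
    refine Kerler.ribbonHopf.congr_of_lay fun x => ?_
    simp only [BTerm.bind, lay_comp, lay_tensor, lay_id]
    exact Kerler.isPairing.right 0 x
  | pairing_ribbon =>
    refine Kerler.ribbonHopf.congr_of_lay fun x => ?_
    simp only [BTerm.bind, lay_comp, lay_tensor, lay_id]
    exact Kerler.isIntegral.pairing_ribbon 0 x Kerler.lay_vp_lam
  | antipode_sq =>
    refine Kerler.ribbonHopf.congr_of_lay fun x => ?_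
    simp only [BTerm.bind, lay_comp, lay_tensor, lay_id]
    exact Kerler.isPairing.antipode_sq 0 x

theorem habiroToKerler_kerlerToHabiro ⦃m n : ℕ⦄ (x : KerlerGen m n) :
    Congr Kerler.Rel ((kerlerToHabiro x).bind habiroToKerler) (.gen x) := by
  have h : ∀ i x, lay Kerler.Rel (((kerlerToHabiro .integralForm).bind habiroToKerler)) i x =
      lay Kerler.Rel Kerler.lam i x := fun i x =>
    (RibbonHopf.lay_form (A := Kerler.ribbonHopf) (Kerler.ribbonHopf.pairing Kerler.lam) i x).trans
      (Kerler.isIntegral.form_eq i x Kerler.lay_vp_lam Kerler.isPairing)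
  cases x with
  | integralForm => exact Kerler.ribbonHopf.congr_of_lay (h 0)
  -- Λ is determined by λ through Λ = (λ ⊗ id) ∘ w, so the round trip for λ suffices.
  | integralElement =>
    refine Kerler.ribbonHopf.congr_of_lay fun x => Eq.trans ?_ (Kerler.isIntegral.copairing 0 x)
    rw [← h]
    exact RibbonHopf.lay_element (A := Kerler.ribbonHopf) _ 0 x
  | _ => exact .refl _

theorem kerlerToHabiro_habiroToKerler ⦃m n : ℕ⦄ (x : HabiroGen m n) :
    Congr Habiro.Rel ((habiroToKerler x).bind kerlerToHabiro) (.gen x) := by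
  cases x with
  | pairing =>
    refine Habiro.ribbonHopf.congr_of_lay fun x => ?_
    have hI := Habiro.isPairing.isIntegral
    have hΛ := fun i x => hI.element_form i x (fun i x => Habiro.isPairing.ribbon_form i x)
      Habiro.isPairing Habiro.lay_pairing_ribbon
    exact (RibbonHopf.pairing_unique (hI.isPairing hΛ).right Habiro.isPairing.left 0 x).symm
  | _ => exact .refl _

/-! ### The equivalence -/

theorem mainTheorem4 :
    ∃ (F : AlgK ⥤ AlgH) (_ : F.Braided) (e : F.obj AlgK.H ≅ AlgH.H),
      F.IsEquivalence ∧
      PreservesHopf F e ∧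
      Functor.LaxMonoidal.ε F ≫ F.map AlgK.copairing ≫
        Functor.OplaxMonoidal.δ F AlgK.H AlgK.H ≫ (e.hom ⊗ₘ e.hom) = AlgH.copairing ∧
      Functor.LaxMonoidal.ε F ≫ F.map AlgK.ribbon ≫ e.hom = AlgH.ribbon ∧
      Functor.LaxMonoidal.ε F ≫ F.map AlgK.ribbonInv ≫ e.hom = AlgH.ribbonInv := by
  have ht : (𝟙 AlgH.H ⊗ₘ 𝟙 AlgH.H) = 𝟙 (AlgH.H ⊗ AlgH.H) :=
    MonoidalCategory.id_tensorHom_id _ _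
  have hl {X Y : AlgH} (f : X ⟶ Y) : 𝟙 X ≫ f ≫ 𝟙 Y = f :=
    (Category.id_comp _).trans (Category.comp_id _)
  have hc {X Y : AlgH} (f : X ⟶ Y) : f ≫ 𝟙 Y = 𝟙 X ≫ f :=
    (Category.comp_id _).trans (Category.id_comp _).symm
  -- The functor is strict and fixes the tensor powers, so `e` is the identity and each
  -- compatibility condition amounts to removing identities.
  refine ⟨PresObj.functor kerlerToHabiro congr_kerlerToHabiro, inferInstance, Iso.refl _,
    PresObj.functor_isEquivalence _ _ congr_habiroToKerler habiroToKerler_kerlerToHabiro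
      kerlerToHabiro_habiroToKerler,
    ⟨?_, hl (X := 𝟙_ AlgH) (MonObj.one (X := AlgH.H)), ?_, ?_, ?_⟩, ?_,
    hl AlgH.ribbon, hl AlgH.ribbonInv⟩
  · exact (Category.comp_id _).trans (PresObj.id_comp_id_comp rfl ht).symm
  · exact (PresObj.comp_id_comp_id ht rfl).trans (Category.id_comp _).symm
  · exact hc (ComonObj.counit (X := AlgH.H))
  · exact hc (HopfObj.antipode (X := AlgH.H))
  · exact (Category.id_comp _).trans (PresObj.comp_id_comp_id ht rfl)
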